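/- **Setting.** Let $a\in\mathbb C$, $a\neq 0$. The quantum extended Galilei group is the complex Hopf algebra $F_q=F_q(\overline{G(1,1)})$ generated by $\mu,x,t,v$ with $$[\mu,x]=-2a\mu,\qquad [\mu,v]=a v^2,\qquad [x,v]=2av$$ (all other commutators of generators vanish), coproduct $$\Delta\mu=\mu\otimes1+1\otimes\mu+v\otimes x+\tfrac12 v^2\otimes t,\quad \Delta x=x\otimes1+1\otimes x+v\otimes t,\quad \Delta t=t\otimes1+1\otimes t,\quad \Delta v=v\otimes1+1\otimes v,$$ counit $\epsilon(\mu)=\epsilon(x)=\epsilon(t)=\epsilon(v)=0$ and antipode $S(\mu)=-\mu+vx-\frac12v^2t$, $S(x)=-x+tv$, $S(t)=-t$, $S(v)=-v$. The monomials $\mu^px^qt^rv^s$ form a basis of $F_q$. Let $\bar\mu,\bar x,\bar t,\bar v$ and $\partial_\mu,\partial_x,\partial_t,\partial_v$ be the multiplications by the variables and the partial derivatives of commuting polynomials, carried over to $F_q$ by this basis. Power series in $\partial_x$ and in $T:=a\,\bar v\,\partial_\mu e^{-2a\partial_x}$ act on $F_q$, since these operators are locally nilpotent. In the dual algebra of $F_q$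 (the linear forms on $F_q$ with product $\langle hk,f\rangle=\langle h,f_{(1)}\rangle\langle k,f_{(2)}\rangle$, where $\Delta f=f_{(1)}\otimes f_{(2)}$) let $I,P,H,N$ be the elements of the dual basis that are dual to $\mu,x,t,v$, and let $e^{cP}$ be the linear form with value $c^q$ at $x^q$ and $0$ at the other basis monomials. Let $U_q=U_q(\overline{\mathfrak g(1,1)})$ be the subalgebra generated by $I,P,H,N$ and $e^{\pm aP}$, and $K\subset U_q$ the Abelian subalgebra generated by $I,P,H,e^{\pm aP}$. The regular actions of $U_q$ on $F_q$ are $$h\succ f=f_{(1)}\langle h,f_{(2)}\rangle,\qquad f\prec h=\langle h,f_{(1)}\rangle f_{(2)}.$$ The representation of $U_q$ coinduced by a character $\chi$ of $K$ acts on $\mathbb C^\uparrow=\{F:U_q\to\mathbb C\ \text{linear}:\ F(kh)=\chi(k)F(h)\ \ \forall k\in K,\,h\in U_q\}$ by $(h\vdash F)(h')=F(h'h)$. A formal series $f=\sum f_{pqrs}\,\mu^px^qt^rv^s$ pairs with $h\in U_q$ by $\langle f,h\rangle=\sum f_{pqrs}\langle h,\mu^px^qt^rv^s\rangle$ when this sum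 converges absolutely. **Theorem.** 0. One has $\langle I^pP^qH^rN^s,\mu^{p'}x^{q'}t^{r'}v^{s'}\rangle=p!\,q!\,r!\,s!\,\delta^p_{p'}\delta^q_{q'}\delta^r_{r'}\delta^s_{s'}$; $\langle e^{\pm aP},f\rangle=\sum_n\frac{(\pm a)^n}{n!}\langle P^n,f\rangle$ for $f\in F_q$; $I,P,H$ commute, and $$[I,N]=-a e^{-2aP}I^2,\qquad [P,N]=-e^{-2aP}I,\qquad [H,N]=-\frac{1-e^{-2aP}}{2a}.$$ For $h,h'\in U_q$ and $f\in F_q$, $\langle h',h\succ f\rangle=\langle h'h,f\rangle$ and $\langle h',f\prec h\rangle=\langle hh',f\rangle$. 1. The left regular action is given by $$I\succ f=(1+T)\,\partial_\mu f,\qquad P\succ f=\Big[\partial_x+\frac1a\ln(1+T)\Big]f,$$ $$H\succ f=\Big[\partial_t+\frac1{2a}\,\bar v\Big(1-\frac{e^{-2a\partial_x}}{1+T}\Big)\Big]f,\qquad N\succ f=\partial_vf .$$ 2. The right regular action is given by $f\prec I=\partial_\mu f$, $f\prec P=\partial_xf$, $f\prec H=\partial_tf$ and $$f\prec N=\Big[\partial_v+a\,\bar\mu\,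 e^{-2a\partial_x}\partial_\mu^2+\bar x\,e^{-2a\partial_x}\partial_\mu+\bar t\,\frac{1-e^{-2a\partial_x}}{2a}\Big]f .$$ 3. Let $\alpha,\beta,\gamma\in\mathbb C$. There is a unique character $\chi$ of $K$ with $\chi(I^pP^qH^r)=\alpha^p\beta^q\gamma^r$ for all $p,q,r\ge 0$ and $\chi(e^{\pm aP})=e^{\pm a\beta}$. A formal series $f$ pairs with every element of $U_q$ and satisfies $\langle f,kh\rangle=\chi(k)\langle f,h\rangle$ for all $k\in K$, $h\in U_q$ if and only if $f=e^{\alpha\mu}e^{\beta x}e^{\gamma t}\phi(v)$ for some $\phi\in\mathbb C[[v]]$. The map $\phi\mapsto\langle e^{\alpha\mu}e^{\beta x}e^{\gamma t}\phi(v),\,\cdot\,\rangle$ is a linear isomorphism of $\mathbb C[[v]]$ onto $\mathbb C^\uparrow$, and it carries the representation coinduced by $\chi$ to the action on $\mathbb C[[v]]$ given by $$I\vdash\phi=\alpha\,(1+a\alpha e^{-2a\beta}v)\,\phi,\qquad P\vdash\phi=\Big[\beta+\frac1a\ln(1+a\alpha e^{-2a\beta}v)\Big]\phi,$$ $$H\vdash\phi=\Big[\gamma+\frac1{2a}\Big(1-\frac{e^{-2a\beta}}{1+a\alpha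 e^{-2a\beta}v}\Big)v\Big]\phi,\qquad N\vdash\phi=\phi'.$$ -/

import Mathlib

open scoped TensorProduct

set_option linter.unusedSimpArgs false
set_option linter.unnecessarySeqFocus false

noncomputable section

namespace QGalilei

/-- The generators of the quantum extended Galilei group. -/
inductive Gen : Type
  | mu | x | t | v

/-- The defining relations: `[μ, x] = -2aμ`, `[μ, v] = a v²`, `[x, v] = 2av`, all other
commutators of generators vanish. -/
inductive Rel (a : ℂ) : FreeAlgebra ℂ Gen → FreeAlgebra ℂ Gen → Prop
  | mu_x : Rel a ((FreeAlgebra.ι ℂ Gen.mu) * (FreeAlgebra.ι ℂ Gen.x)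
        - (FreeAlgebra.ι ℂ Gen.x) * (FreeAlgebra.ι ℂ Gen.mu))
      ((-2 * a) • (FreeAlgebra.ι ℂ Gen.mu))
  | mu_v : Rel a ((FreeAlgebra.ι ℂ Gen.mu) * (FreeAlgebra.ι ℂ Gen.v)
        - (FreeAlgebra.ι ℂ Gen.v) * (FreeAlgebra.ι ℂ Gen.mu))
      (a • (FreeAlgebra.ι ℂ Gen.v) ^ 2)
  | x_v : Rel a ((FreeAlgebra.ι ℂ Gen.x) * (FreeAlgebra.ι ℂ Gen.v)
        - (FreeAlgebra.ι ℂ Gen.v) * (FreeAlgebra.ι ℂ Gen.x))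
      ((2 * a) • (FreeAlgebra.ι ℂ Gen.v))
  | mu_t : Rel a ((FreeAlgebra.ι ℂ Gen.mu) * (FreeAlgebra.ι ℂ Gen.t)
        - (FreeAlgebra.ι ℂ Gen.t) * (FreeAlgebra.ι ℂ Gen.mu)) 0
  | x_t : Rel a ((FreeAlgebra.ι ℂ Gen.x) * (FreeAlgebra.ι ℂ Gen.t)
        - (FreeAlgebra.ι ℂ Gen.t) * (FreeAlgebra.ι ℂ Gen.x)) 0
  | v_t : Rel a ((FreeAlgebra.ι ℂ Gen.v) * (FreeAlgebra.ι ℂ Gen.t)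
        - (FreeAlgebra.ι ℂ Gen.t) * (FreeAlgebra.ι ℂ Gen.v)) 0

/-- The algebra `F_q` of the quantum extended Galilei group, by generators and relations. -/
def Fq (a : ℂ) : Type := RingQuot (Rel a)

instance (a : ℂ) : Ring (Fq a) := inferInstanceAs (Ring (RingQuot (Rel a)))
instance (a : ℂ) : Algebra ℂ (Fq a) := inferInstanceAs (Algebra ℂ (RingQuot (Rel a)))

namespace Fq

/-- The class of a generator in `F_q`. -/
def gen (a : ℂ) (g : Gen) : Fq a := RingQuot.mkAlgHom ℂ (Rel a) (FreeAlgebra.ι ℂ g)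

/-- The generator `μ`. -/
abbrev mu (a : ℂ) : Fq a := gen a Gen.mu
/-- The generator `x`. -/
abbrev x (a : ℂ) : Fq a := gen a Gen.x
/-- The generator `t`. -/
abbrev t (a : ℂ) : Fq a := gen a Gen.t
/-- The generator `v`. -/
abbrev v (a : ℂ) : Fq a := gen a Gen.v

variable (a : ℂ)

lemma x_mu : x a * mu a = mu a * x a + (2 * a) • mu a := by
  have h : RingQuot.mkAlgHom ℂ (Rel a) _ = RingQuot.mkAlgHom ℂ (Rel a) _ :=
    RingQuot.mkAlgHom_rel ℂ (Rel.mu_x (a := a))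
  simp only [map_sub, map_mul, map_smul] at h
  have h' : mu a * x a - x a * mu a = (-2 * a) • mu a := h
  rw [sub_eq_iff_eq_add] at h'
  rw [h']; module

lemma v_mu : v a * mu a = mu a * v a - a • v a ^ 2 := by
  have h : RingQuot.mkAlgHom ℂ (Rel a) _ = RingQuot.mkAlgHom ℂ (Rel a) _ :=
    RingQuot.mkAlgHom_rel ℂ (Rel.mu_v (a := a))
  simp only [map_sub, map_mul, map_smul, map_pow] at h
  have h' : mu a * v a - v a * mu a = a • v a ^ 2 := h
  rw [sub_eq_iff_eq_add] at h'
  rw [h']; module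

lemma v_x : v a * x a = x a * v a - (2 * a) • v a := by
  have h : RingQuot.mkAlgHom ℂ (Rel a) _ = RingQuot.mkAlgHom ℂ (Rel a) _ :=
    RingQuot.mkAlgHom_rel ℂ (Rel.x_v (a := a))
  simp only [map_sub, map_mul, map_smul] at h
  have h' : x a * v a - v a * x a = (2 * a) • v a := h
  rw [sub_eq_iff_eq_add] at h'
  rw [h']; module

lemma t_mu : t a * mu a = mu a * t a := by
  have h : RingQuot.mkAlgHom ℂ (Rel a) _ = RingQuot.mkAlgHom ℂ (Rel a) _ :=
    RingQuot.mkAlgHom_rel ℂ (Rel.mu_t (a := a))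
  simp only [map_sub, map_mul, map_zero] at h
  exact (sub_eq_zero.1 h).symm

lemma t_x : t a * x a = x a * t a := by
  have h : RingQuot.mkAlgHom ℂ (Rel a) _ = RingQuot.mkAlgHom ℂ (Rel a) _ :=
    RingQuot.mkAlgHom_rel ℂ (Rel.x_t (a := a))
  simp only [map_sub, map_mul, map_zero] at h
  exact (sub_eq_zero.1 h).symm

lemma v_t : v a * t a = t a * v a := by
  have h : RingQuot.mkAlgHom ℂ (Rel a) _ = RingQuot.mkAlgHom ℂ (Rel a) _ :=
    RingQuot.mkAlgHom_rel ℂ (Rel.v_t (a := a))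
  simp only [map_sub, map_mul, map_zero] at h
  exact sub_eq_zero.1 h

variable {a} {B : Type*} [Ring B] [Algebra ℂ B]

/-- The universal property of `F_q`. -/
def lift (f : Gen → B)
    (h_mu_x : f .mu * f .x - f .x * f .mu = (-2 * a) • f .mu)
    (h_mu_v : f .mu * f .v - f .v * f .mu = a • f .v ^ 2)
    (h_x_v : f .x * f .v - f .v * f .x = (2 * a) • f .v)
    (h_mu_t : f .mu * f .t - f .t * f .mu = 0)
    (h_x_t : f .x * f .t - f .t * f .x = 0)
    (h_v_t : f .v * f .t - f .t * f .v = 0) : Fq a →ₐ[ℂ] B :=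
  RingQuot.liftAlgHom ℂ ⟨FreeAlgebra.lift ℂ f, by
    intro p q h
    cases h <;> simp_all⟩

@[simp] lemma lift_gen (f : Gen → B) (h1 h2 h3 h4 h5 h6) (g : Gen) :
    lift (a := a) f h1 h2 h3 h4 h5 h6 (gen a g) = f g := by
  unfold lift gen
  erw [RingQuot.liftAlgHom_mkAlgHom_apply]
  simp

lemma hom_ext {f g : Fq a →ₐ[ℂ] B} (h : ∀ i, f (gen a i) = g (gen a i)) : f = g := by
  apply RingQuot.ringQuot_ext'
  apply FreeAlgebra.hom_ext
  funext i
  exact h i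

lemma induction {P : Fq a → Prop} (hC : ∀ c : ℂ, P (algebraMap ℂ _ c)) (hg : ∀ g, P (gen a g))
    (hm : ∀ f g, P f → P g → P (f * g)) (hp : ∀ f g, P f → P g → P (f + g)) (f : Fq a) : P f := by
  obtain ⟨w, rfl⟩ := RingQuot.mkAlgHom_surjective ℂ (Rel a) f
  induction w using FreeAlgebra.induction with
  | grade0 c => rw [AlgHom.commutes]; exact hC c
  | grade1 i => exact hg i
  | mul p q h1 h2 => rw [map_mul]; exact hm _ _ h1 h2
  | add p q h1 h2 => rw [map_add]; exact hp _ _ h1 h2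

/-- The coproduct on generators. -/
def comulGen (a : ℂ) : Gen → Fq a ⊗[ℂ] Fq a
  | .mu => mu a ⊗ₜ 1 + 1 ⊗ₜ mu a + v a ⊗ₜ x a + (1 / 2 : ℂ) • (v a ^ 2) ⊗ₜ t a
  | .x => x a ⊗ₜ 1 + 1 ⊗ₜ x a + v a ⊗ₜ t a
  | .t => t a ⊗ₜ 1 + 1 ⊗ₜ t a
  | .v => v a ⊗ₜ 1 + 1 ⊗ₜ v a

/-- The antipode on generators. -/
def antipodeGen (a : ℂ) : Gen → (Fq a)ᵐᵒᵖ
  | .mu => .op (-mu a + v a * x a - (1 / 2 : ℂ) • (v a ^ 2 * t a))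
  | .x => .op (-x a + t a * v a)
  | .t => .op (-t a)
  | .v => .op (-v a)

lemma x_mu' (w : Fq a) : x a * (mu a * w) = mu a * (x a * w) + (2 * a) • (mu a * w) := by
  rw [← mul_assoc, x_mu, add_mul, smul_mul_assoc, mul_assoc]

lemma v_mu' (w : Fq a) : v a * (mu a * w) = mu a * (v a * w) - a • (v a * (v a * w)) := by
  rw [← mul_assoc, v_mu, sub_mul, smul_mul_assoc, mul_assoc, pow_two, mul_assoc]

lemma v_x' (w : Fq a) : v a * (x a * w) = x a * (v a * w) - (2 * a) • (v a * w) := by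
  rw [← mul_assoc, v_x, sub_mul, smul_mul_assoc, mul_assoc]

lemma t_mu' (w : Fq a) : t a * (mu a * w) = mu a * (t a * w) := by
  rw [← mul_assoc, t_mu, mul_assoc]

lemma t_x' (w : Fq a) : t a * (x a * w) = x a * (t a * w) := by
  rw [← mul_assoc, t_x, mul_assoc]

lemma v_t' (w : Fq a) : v a * (t a * w) = t a * (v a * w) := by
  rw [← mul_assoc, v_t, mul_assoc]

/-- The coproduct of `F_q` as an algebra morphism. -/
def comulHom (a : ℂ) : Fq a →ₐ[ℂ] Fq a ⊗[ℂ] Fq a :=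
  lift (comulGen a)
    (by
      simp only [comulGen, add_mul, mul_add, Algebra.TensorProduct.tmul_mul_tmul, mul_one, one_mul,
        pow_succ, pow_zero, mul_assoc, smul_mul_assoc, mul_smul_comm, ← TensorProduct.smul_tmul',
        x_mu, v_mu, v_x, t_mu, t_x, v_t, x_mu', v_mu', v_x', t_mu', t_x', v_t', mul_sub,
        TensorProduct.tmul_add, TensorProduct.add_tmul, TensorProduct.tmul_sub,
        TensorProduct.sub_tmul, TensorProduct.tmul_smul, smul_sub, smul_add]
      module)
    (by
      simp only [comulGen, add_mul, mul_add, Algebra.TensorProduct.tmul_mul_tmul, mul_one, one_mul,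
        pow_succ, pow_zero, mul_assoc, smul_mul_assoc, mul_smul_comm, ← TensorProduct.smul_tmul',
        x_mu, v_mu, v_x, t_mu, t_x, v_t, x_mu', v_mu', v_x', t_mu', t_x', v_t', mul_sub,
        TensorProduct.tmul_add, TensorProduct.add_tmul, TensorProduct.tmul_sub,
        TensorProduct.sub_tmul, TensorProduct.tmul_smul, smul_sub, smul_add]
      module)
    (by
      simp only [comulGen, add_mul, mul_add, Algebra.TensorProduct.tmul_mul_tmul, mul_one, one_mul,
        pow_succ, pow_zero, mul_assoc, smul_mul_assoc, mul_smul_comm, ← TensorProduct.smul_tmul',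
        x_mu, v_mu, v_x, t_mu, t_x, v_t, x_mu', v_mu', v_x', t_mu', t_x', v_t', mul_sub,
        TensorProduct.tmul_add, TensorProduct.add_tmul, TensorProduct.tmul_sub,
        TensorProduct.sub_tmul, TensorProduct.tmul_smul, smul_sub, smul_add]
      module)
    (by
      simp only [comulGen, add_mul, mul_add, Algebra.TensorProduct.tmul_mul_tmul, mul_one, one_mul,
        pow_succ, pow_zero, mul_assoc, smul_mul_assoc, mul_smul_comm, ← TensorProduct.smul_tmul',
        x_mu, v_mu, v_x, t_mu, t_x, v_t, x_mu', v_mu', v_x', t_mu', t_x', v_t', mul_sub,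
        TensorProduct.tmul_add, TensorProduct.add_tmul, TensorProduct.tmul_sub,
        TensorProduct.sub_tmul, TensorProduct.tmul_smul, smul_sub, smul_add]
      module)
    (by
      simp only [comulGen, add_mul, mul_add, Algebra.TensorProduct.tmul_mul_tmul, mul_one, one_mul,
        pow_succ, pow_zero, mul_assoc, smul_mul_assoc, mul_smul_comm, ← TensorProduct.smul_tmul',
        x_mu, v_mu, v_x, t_mu, t_x, v_t, x_mu', v_mu', v_x', t_mu', t_x', v_t', mul_sub,
        TensorProduct.tmul_add, TensorProduct.add_tmul, TensorProduct.tmul_sub,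
        TensorProduct.sub_tmul, TensorProduct.tmul_smul, smul_sub, smul_add]
      module)
    (by
      simp only [comulGen, add_mul, mul_add, Algebra.TensorProduct.tmul_mul_tmul, mul_one, one_mul,
        pow_succ, pow_zero, mul_assoc, smul_mul_assoc, mul_smul_comm, ← TensorProduct.smul_tmul',
        x_mu, v_mu, v_x, t_mu, t_x, v_t, x_mu', v_mu', v_x', t_mu', t_x', v_t', mul_sub,
        TensorProduct.tmul_add, TensorProduct.add_tmul, TensorProduct.tmul_sub,
        TensorProduct.sub_tmul, TensorProduct.tmul_smul, smul_sub, smul_add]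
      module)

/-- The counit of `F_q` as an algebra morphism; it kills the generators. -/
def counitHom (a : ℂ) : Fq a →ₐ[ℂ] ℂ :=
  lift (fun _ => 0) (by simp) (by simp) (by simp) (by simp) (by simp) (by simp)

instance (a : ℂ) : Bialgebra ℂ (Fq a) :=
  Bialgebra.ofAlgHom (comulHom a) (counitHom a)
    (by
      apply hom_ext
      intro i
      cases i <;>
      simp [comulHom, comulGen, Algebra.TensorProduct.one_def, TensorProduct.tmul_add,
        TensorProduct.add_tmul, pow_two, add_mul, mul_add, ← TensorProduct.smul_tmul'] <;>
      module)
    (by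
      apply hom_ext
      intro i
      cases i <;> simp [comulHom, counitHom, comulGen, Algebra.TensorProduct.one_def])
    (by
      apply hom_ext
      intro i
      cases i <;> simp [comulHom, counitHom, comulGen, Algebra.TensorProduct.one_def])

/-- The antipode of `F_q` as an algebra morphism to the opposite algebra. -/
def antipodeHom (a : ℂ) : Fq a →ₐ[ℂ] (Fq a)ᵐᵒᵖ :=
  lift (antipodeGen a)
    (by
      apply MulOpposite.unop_injective
      simp only [antipodeGen, MulOpposite.unop_sub, MulOpposite.unop_mul, MulOpposite.unop_op,
        MulOpposite.unop_smul, MulOpposite.unop_zero, MulOpposite.unop_pow, add_mul, mul_add,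
        mul_sub, sub_mul, mul_neg, neg_mul, smul_neg, neg_neg,
        mul_one, one_mul, pow_succ, pow_zero, mul_assoc, smul_mul_assoc, mul_smul_comm,
        x_mu, v_mu, v_x, t_mu, t_x, v_t, x_mu', v_mu', v_x', t_mu', t_x', v_t', smul_sub, smul_add]
      module)
    (by
      apply MulOpposite.unop_injective
      simp only [antipodeGen, MulOpposite.unop_sub, MulOpposite.unop_mul, MulOpposite.unop_op,
        MulOpposite.unop_smul, MulOpposite.unop_zero, MulOpposite.unop_pow, add_mul, mul_add,
        mul_sub, sub_mul, mul_neg, neg_mul, smul_neg, neg_neg,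
        mul_one, one_mul, pow_succ, pow_zero, mul_assoc, smul_mul_assoc, mul_smul_comm,
        x_mu, v_mu, v_x, t_mu, t_x, v_t, x_mu', v_mu', v_x', t_mu', t_x', v_t', smul_sub, smul_add]
      module)
    (by
      apply MulOpposite.unop_injective
      simp only [antipodeGen, MulOpposite.unop_sub, MulOpposite.unop_mul, MulOpposite.unop_op,
        MulOpposite.unop_smul, MulOpposite.unop_zero, MulOpposite.unop_pow, add_mul, mul_add,
        mul_sub, sub_mul, mul_neg, neg_mul, smul_neg, neg_neg,
        mul_one, one_mul, pow_succ, pow_zero, mul_assoc, smul_mul_assoc, mul_smul_comm,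
        x_mu, v_mu, v_x, t_mu, t_x, v_t, x_mu', v_mu', v_x', t_mu', t_x', v_t', smul_sub, smul_add]
      module)
    (by
      apply MulOpposite.unop_injective
      simp only [antipodeGen, MulOpposite.unop_sub, MulOpposite.unop_mul, MulOpposite.unop_op,
        MulOpposite.unop_smul, MulOpposite.unop_zero, MulOpposite.unop_pow, add_mul, mul_add,
        mul_sub, sub_mul, mul_neg, neg_mul, smul_neg, neg_neg,
        mul_one, one_mul, pow_succ, pow_zero, mul_assoc, smul_mul_assoc, mul_smul_comm,
        x_mu, v_mu, v_x, t_mu, t_x, v_t, x_mu', v_mu', v_x', t_mu', t_x', v_t', smul_sub, smul_add]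
      module)
    (by
      apply MulOpposite.unop_injective
      simp only [antipodeGen, MulOpposite.unop_sub, MulOpposite.unop_mul, MulOpposite.unop_op,
        MulOpposite.unop_smul, MulOpposite.unop_zero, MulOpposite.unop_pow, add_mul, mul_add,
        mul_sub, sub_mul, mul_neg, neg_mul, smul_neg, neg_neg,
        mul_one, one_mul, pow_succ, pow_zero, mul_assoc, smul_mul_assoc, mul_smul_comm,
        x_mu, v_mu, v_x, t_mu, t_x, v_t, x_mu', v_mu', v_x', t_mu', t_x', v_t', smul_sub, smul_add]
      module)
    (by
      apply MulOpposite.unop_injective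
      simp only [antipodeGen, MulOpposite.unop_sub, MulOpposite.unop_mul, MulOpposite.unop_op,
        MulOpposite.unop_smul, MulOpposite.unop_zero, MulOpposite.unop_pow, add_mul, mul_add,
        mul_sub, sub_mul, mul_neg, neg_mul, smul_neg, neg_neg,
        mul_one, one_mul, pow_succ, pow_zero, mul_assoc, smul_mul_assoc, mul_smul_comm,
        x_mu, v_mu, v_x, t_mu, t_x, v_t, x_mu', v_mu', v_x', t_mu', t_x', v_t', smul_sub, smul_add]
      module)

/-- The antipode of `F_q`. -/
def antipodeLin (a : ℂ) : Fq a →ₗ[ℂ] Fq a :=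
  (MulOpposite.opLinearEquiv ℂ).symm.toLinearMap ∘ₗ (antipodeHom a).toLinearMap

lemma antipodeLin_mul (f g : Fq a) : antipodeLin a (f * g) = antipodeLin a g * antipodeLin a f := by
  simp [antipodeLin]

lemma antipodeL_mul (X : Fq a ⊗[ℂ] Fq a) (p q : Fq a) :
    LinearMap.mul' ℂ _ ((antipodeLin a).rTensor _ (X * p ⊗ₜ q)) =
      antipodeLin a p * LinearMap.mul' ℂ _ ((antipodeLin a).rTensor _ X) * q := by
  induction X using TensorProduct.induction_on with
  | zero => simp
  | tmul y z => simp [antipodeLin_mul, mul_assoc]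
  | add y z hy hz => simp only [add_mul, map_add, hy, hz, mul_add]

lemma antipodeR_mul (X : Fq a ⊗[ℂ] Fq a) (p q : Fq a) :
    LinearMap.mul' ℂ _ ((antipodeLin a).lTensor _ (p ⊗ₜ q * X)) =
      p * LinearMap.mul' ℂ _ ((antipodeLin a).lTensor _ X) * antipodeLin a q := by
  induction X using TensorProduct.induction_on with
  | zero => simp
  | tmul y z => simp [antipodeLin_mul, mul_assoc]
  | add y z hy hz => simp only [add_mul, map_add, hy, hz, mul_add]

lemma antipodeL_mul_of (X Y : Fq a ⊗[ℂ] Fq a) (c : ℂ)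
    (h : LinearMap.mul' ℂ _ ((antipodeLin a).rTensor _ X) = algebraMap ℂ _ c) :
    LinearMap.mul' ℂ _ ((antipodeLin a).rTensor _ (X * Y)) =
      c • LinearMap.mul' ℂ _ ((antipodeLin a).rTensor _ Y) := by
  induction Y using TensorProduct.induction_on with
  | zero => simp
  | tmul y z =>
    rw [antipodeL_mul, h, ← Algebra.commutes, mul_assoc, ← Algebra.smul_def]
    simp
  | add y z hy hz => simp only [mul_add, map_add, hy, hz, smul_add]

lemma antipodeR_mul_of (X Y : Fq a ⊗[ℂ] Fq a) (c : ℂ)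
    (h : LinearMap.mul' ℂ _ ((antipodeLin a).lTensor _ X) = algebraMap ℂ _ c) :
    LinearMap.mul' ℂ _ ((antipodeLin a).lTensor _ (Y * X)) =
      c • LinearMap.mul' ℂ _ ((antipodeLin a).lTensor _ Y) := by
  induction Y using TensorProduct.induction_on with
  | zero => simp
  | tmul y z =>
    rw [antipodeR_mul, h, ← Algebra.commutes, mul_assoc, ← Algebra.smul_def]
    simp
  | add y z hy hz => simp only [add_mul, map_add, hy, hz, smul_add]

instance (a : ℂ) : HopfAlgebra ℂ (Fq a) where
  antipode := antipodeLin a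
  mul_antipode_rTensor_comul := by
    ext f
    induction f using induction with
    | hC c => simp [antipodeLin, Algebra.TensorProduct.algebraMap_apply]
    | hg g =>
      change LinearMap.mul' ℂ _ ((antipodeLin a).rTensor _ (comulHom a (gen a g))) =
        algebraMap ℂ _ (counitHom a (gen a g))
      cases g <;> simp [comulHom, comulGen, antipodeLin, antipodeHom, antipodeGen, counitHom, v_t] <;>
        module
    | hm f g hf hg =>
      simp only [LinearMap.comp_apply, Bialgebra.comul_mul, Bialgebra.counit_mul,
        Algebra.linearMap_apply] at hf hg ⊢
      rw [antipodeL_mul_of _ _ _ hf, hg, map_mul, Algebra.smul_def]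
    | hp f g hf hg => simp_all
  mul_antipode_lTensor_comul := by
    ext f
    induction f using induction with
    | hC c => simp [antipodeLin, Algebra.TensorProduct.algebraMap_apply]
    | hg g =>
      change LinearMap.mul' ℂ _ ((antipodeLin a).lTensor _ (comulHom a (gen a g))) =
        algebraMap ℂ _ (counitHom a (gen a g))
      cases g <;> simp [comulHom, comulGen, antipodeLin, antipodeHom, antipodeGen, counitHom,
        mul_add, v_t', pow_two, mul_assoc, v_t] <;> module
    | hm f g hf hg =>
      simp only [LinearMap.comp_apply, Bialgebra.comul_mul, Bialgebra.counit_mul,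
        Algebra.linearMap_apply] at hf hg ⊢
      rw [antipodeR_mul_of _ _ _ hg, hf, map_mul, Algebra.smul_def, Algebra.commutes]
    | hp f g hf hg => simp_all


open MvPolynomial in
/-- Right multiplication by the generators, written on normally ordered polynomials. -/
def rightGen (a : ℂ) : Gen → (Module.End ℂ (MvPolynomial (Fin 4) ℂ))ᵐᵒᵖ
  | .mu => .op (LinearMap.mulLeft ℂ (X 0) ∘ₗ
        (bind₁ ![X 0, X 1 + C (2 * a), X 2, X 3] : MvPolynomial (Fin 4) ℂ →ₐ[ℂ] _).toLinearMap
      - LinearMap.mulLeft ℂ (C a * X 3 ^ 2) ∘ₗ (pderiv 3).toLinearMap)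
  | .x => .op (LinearMap.mulLeft ℂ (X 1)
      - LinearMap.mulLeft ℂ (C (2 * a) * X 3) ∘ₗ (pderiv 3).toLinearMap)
  | .t => .op (LinearMap.mulLeft ℂ (X 2))
  | .v => .op (LinearMap.mulLeft ℂ (X 3))

open MvPolynomial in
lemma shift_pderiv (c : ℂ) (f : MvPolynomial (Fin 4) ℂ) :
    pderiv 3 (bind₁ ![X 0, X 1 + C c, X 2, X 3] f : MvPolynomial (Fin 4) ℂ) =
      bind₁ ![X 0, X 1 + C c, X 2, X 3] (pderiv 3 f) := by
  induction f using MvPolynomial.induction_on with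
  | C b => simp
  | add p q hp hq => simp only [map_add, hp, hq]
  | mul_X p i hp =>
    simp only [map_mul, bind₁_X_right, pderiv_mul, hp, map_add]
    fin_cases i <;> simp [pderiv_X]

open MvPolynomial in
/-- The right regular action of `F_q` on itself, written on normally ordered polynomials. -/
def rightHom (a : ℂ) : Fq a →ₐ[ℂ] (Module.End ℂ (MvPolynomial (Fin 4) ℂ))ᵐᵒᵖ :=
  lift (rightGen a)
    (by
      apply MulOpposite.unop_injective
      refine LinearMap.ext fun f => ?_
      have h := shift_pderiv (2 * a) f
      simp only [map_mul] at h
      simp [rightGen, pderiv_X, MvPolynomial.smul_eq_C_mul]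
      linear_combination (-(X 0 * C 2 * C a * X 3)) * h)
    (by
      apply MulOpposite.unop_injective
      refine LinearMap.ext fun f => ?_
      simp [rightGen, shift_pderiv, pderiv_X, MvPolynomial.smul_eq_C_mul, pow_two]
      ring)
    (by
      apply MulOpposite.unop_injective
      refine LinearMap.ext fun f => ?_
      simp [rightGen, shift_pderiv, pderiv_X, MvPolynomial.smul_eq_C_mul]
      ring)
    (by
      apply MulOpposite.unop_injective
      refine LinearMap.ext fun f => ?_
      simp [rightGen, shift_pderiv, pderiv_X, MvPolynomial.smul_eq_C_mul]
      ring)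
    (by
      apply MulOpposite.unop_injective
      refine LinearMap.ext fun f => ?_
      simp [rightGen, shift_pderiv, pderiv_X, MvPolynomial.smul_eq_C_mul]
      ring)
    (by
      apply MulOpposite.unop_injective
      refine LinearMap.ext fun f => ?_
      simp [rightGen, shift_pderiv, pderiv_X, MvPolynomial.smul_eq_C_mul]
      try ring)

/-- The normally ordered monomial `μ^{m 0} x^{m 1} t^{m 2} v^{m 3}`. -/
def ordMon (a : ℂ) (m : Fin 4 →₀ ℕ) : Fq a :=
  mu a ^ m 0 * x a ^ m 1 * t a ^ m 2 * v a ^ m 3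

/-- The linear map sending a commutative monomial to the normally ordered one. -/
def ordLin (a : ℂ) : MvPolynomial (Fin 4) ℂ →ₗ[ℂ] Fq a :=
  (MvPolynomial.basisMonomials (Fin 4) ℂ).constr ℂ (ordMon a)

@[simp] lemma ordLin_monomial (m : Fin 4 →₀ ℕ) (c : ℂ) :
    ordLin a (MvPolynomial.monomial m c) = c • ordMon a m := by
  have h : MvPolynomial.monomial m c = c • (MvPolynomial.basisMonomials (Fin 4) ℂ) m := by
    simp [MvPolynomial.smul_monomial]
  rw [h, map_smul, ordLin, Module.Basis.constr_basis]

open MvPolynomial in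
lemma ordLin_mon4 (p q r s : ℕ) :
    ordLin a (X 0 ^ p * X 1 ^ q * X 2 ^ r * X 3 ^ s) = mu a ^ p * x a ^ q * t a ^ r * v a ^ s := by
  have h : (X 0 ^ p * X 1 ^ q * X 2 ^ r * X 3 ^ s : MvPolynomial (Fin 4) ℂ) =
      monomial (Finsupp.single 0 p + Finsupp.single 1 q + Finsupp.single 2 r
        + Finsupp.single 3 s) 1 := by
    simp [X_pow_eq_monomial, monomial_mul]
  rw [h, ordLin_monomial]
  simp [ordMon]

open MvPolynomial in
lemma mon4_induction {P : MvPolynomial (Fin 4) ℂ → Prop}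
    (h : ∀ p q r s, P (X 0 ^ p * X 1 ^ q * X 2 ^ r * X 3 ^ s))
    (hp : ∀ f g, P f → P g → P (f + g)) (hc : ∀ (c : ℂ) f, P f → P (c • f))
    (f : MvPolynomial (Fin 4) ℂ) : P f := by
  induction f using MvPolynomial.induction_on' with
  | add p q hp' hq => exact hp _ _ hp' hq
  | monomial m c =>
    have := hc c _ (h (m 0) (m 1) (m 2) (m 3))
    convert this using 1
    rw [monomial_eq, Finsupp.prod_fintype _ _ (by simp), Fin.prod_univ_four,
      MvPolynomial.smul_eq_C_mul]

open MvPolynomial in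
lemma ordLin_poly (p r s : ℕ) (Q : Polynomial ℂ) :
    ordLin a (X 0 ^ p * Polynomial.aeval (X 1) Q * X 2 ^ r * X 3 ^ s) =
      mu a ^ p * Polynomial.aeval (x a) Q * t a ^ r * v a ^ s := by
  induction Q using Polynomial.induction_on' with
  | add P Q hP hQ => simp only [map_add, mul_add, add_mul, hP, hQ]
  | monomial n c =>
    have := ordLin_mon4 (a := a) p n r s
    rw [← Polynomial.C_mul_X_pow_eq_monomial, ← Polynomial.smul_eq_C_mul]
    simp only [map_smul, Polynomial.aeval_X, map_pow, mul_smul_comm, smul_mul_assoc, this]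

lemma v_pow_mu (s : ℕ) : v a ^ s * mu a = mu a * v a ^ s - (a * s) • v a ^ (s + 1) := by
  induction s with
  | zero => simp
  | succ s ih =>
    have h1 : v a * (v a * v a ^ s) = v a ^ (s + 1 + 1) := by rw [pow_succ', pow_succ']
    have h2 : v a * v a ^ s = v a ^ (s + 1) := (pow_succ' _ _).symm
    have h3 : v a * v a ^ (s + 1) = v a ^ (s + 1 + 1) := (pow_succ' _ _).symm
    rw [← h2, mul_assoc, ih, mul_sub, v_mu', mul_smul_comm, h1, h2, h3]
    push_cast
    module

lemma v_pow_x (s : ℕ) : v a ^ s * x a = x a * v a ^ s - (2 * a * s) • v a ^ s := by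
  induction s with
  | zero => simp
  | succ s ih =>
    rw [pow_succ', mul_assoc, ih, mul_sub, v_x', mul_smul_comm, ← pow_succ']
    push_cast
    module

lemma x_pow_mu (q : ℕ) : x a ^ q * mu a = mu a * (x a + algebraMap ℂ _ (2 * a)) ^ q := by
  induction q with
  | zero => simp
  | succ q ih =>
    rw [pow_succ', mul_assoc, ih, pow_succ' _ q, ← mul_assoc, x_mu, ← mul_assoc, mul_add (mu a),
      ← Algebra.commutes, Algebra.smul_def]

lemma t_pow_x (r : ℕ) : t a ^ r * x a = x a * t a ^ r :=
  (Commute.pow_left (show Commute (t a) (x a) from t_x a) r)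

lemma t_pow_mu (r : ℕ) : t a ^ r * mu a = mu a * t a ^ r :=
  (Commute.pow_left (show Commute (t a) (mu a) from t_mu a) r)

lemma v_pow_t (s : ℕ) : v a ^ s * t a = t a * v a ^ s :=
  (Commute.pow_left (show Commute (v a) (t a) from v_t a) s)

open MvPolynomial in
lemma mul_pderiv_mon4 (p q r s : ℕ) :
    X 3 * pderiv 3 (X 0 ^ p * X 1 ^ q * X 2 ^ r * X 3 ^ s : MvPolynomial (Fin 4) ℂ) =
      (s : ℂ) • (X 0 ^ p * X 1 ^ q * X 2 ^ r * X 3 ^ s) := by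
  rw [smul_eq_C_mul]
  simp only [pderiv_mul, pderiv_pow, pderiv_X, Pi.single_apply]
  rcases s with _ | s <;> simp
  ring

open MvPolynomial in
lemma ordLin_right (g : Gen) (f : MvPolynomial (Fin 4) ℂ) :
    ordLin a ((rightGen a g).unop f) = ordLin a f * gen a g := by
  induction f using mon4_induction with
  | hp f g hf hg => simp only [map_add, hf, hg, add_mul]
  | hc c f hf => simp only [map_smul, hf, smul_mul_assoc]
  | h p q r s =>
    have hd := mul_pderiv_mon4 p q r s
    cases g
    · have h1 : (rightGen a Gen.mu).unop (X 0 ^ p * X 1 ^ q * X 2 ^ r * X 3 ^ s) =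
          X 0 ^ (p + 1) * Polynomial.aeval (X 1) ((Polynomial.X + Polynomial.C (2 * a)) ^ q)
            * X 2 ^ r * X 3 ^ s
          - (a * s) • (X 0 ^ p * X 1 ^ q * X 2 ^ r * X 3 ^ (s + 1)) := by
        have h2 : (rightGen a Gen.mu).unop (X 0 ^ p * X 1 ^ q * X 2 ^ r * X 3 ^ s) =
          X 0 * bind₁ ![X 0, X 1 + C (2 * a), X 2, X 3] (X 0 ^ p * X 1 ^ q * X 2 ^ r * X 3 ^ s)
            - C a * X 3 * (X 3 * pderiv 3 (X 0 ^ p * X 1 ^ q * X 2 ^ r * X 3 ^ s)) := by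
          simp only [rightGen, MulOpposite.unop_op, LinearMap.sub_apply, LinearMap.comp_apply,
            LinearMap.mulLeft_apply]
          simp only [AlgHom.toLinearMap_apply, Derivation.coeFn_coe]
          ring
        rw [h2, hd]
        simp only [map_mul, map_pow, bind₁_X_right, map_add, Polynomial.aeval_X, Polynomial.aeval_C,
          smul_eq_C_mul, algebraMap_eq]
        simp
        ring
      rw [h1, map_sub, map_smul, ordLin_poly, ordLin_mon4, ordLin_mon4, mul_assoc _ (v a ^ s),
        v_pow_mu, mul_sub, ← mul_assoc _ (mu a), mul_assoc _ _ (mu a), t_pow_mu, ← mul_assoc _ (mu a),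
        mul_assoc _ _ (mu a), x_pow_mu, mul_smul_comm]
      simp only [map_pow, map_add, Polynomial.aeval_X, Polynomial.aeval_C, pow_succ, mul_assoc]
    · have h2 : (rightGen a Gen.x).unop (X 0 ^ p * X 1 ^ q * X 2 ^ r * X 3 ^ s) =
          X 0 ^ p * X 1 ^ (q + 1) * X 2 ^ r * X 3 ^ s
            - C (2 * a) * (X 3 * pderiv 3 (X 0 ^ p * X 1 ^ q * X 2 ^ r * X 3 ^ s)) := by
        simp only [rightGen, MulOpposite.unop_op, LinearMap.sub_apply, LinearMap.comp_apply,
          LinearMap.mulLeft_apply]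
        simp only [Derivation.coeFn_coe]
        ring
      rw [h2, hd, ← smul_eq_C_mul, map_sub, map_smul, map_smul, ordLin_mon4, ordLin_mon4,
        mul_assoc _ (v a ^ s), v_pow_x, mul_sub, ← mul_assoc _ (x a), mul_assoc _ _ (x a), t_pow_x,
        mul_smul_comm, smul_smul]
      simp only [pow_succ, mul_assoc]
    · have h2 : (rightGen a Gen.t).unop (X 0 ^ p * X 1 ^ q * X 2 ^ r * X 3 ^ s) =
          X 0 ^ p * X 1 ^ q * X 2 ^ (r + 1) * X 3 ^ s := by
        simp only [rightGen, MulOpposite.unop_op, LinearMap.mulLeft_apply]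
        ring
      rw [h2, ordLin_mon4, ordLin_mon4, mul_assoc _ (v a ^ s), v_pow_t]
      simp only [pow_succ, mul_assoc]
    · have h2 : (rightGen a Gen.v).unop (X 0 ^ p * X 1 ^ q * X 2 ^ r * X 3 ^ s) =
          X 0 ^ p * X 1 ^ q * X 2 ^ r * X 3 ^ (s + 1) := by
        simp only [rightGen, MulOpposite.unop_op, LinearMap.mulLeft_apply]
        ring
      rw [h2, ordLin_mon4, ordLin_mon4]
      simp only [pow_succ, mul_assoc]

lemma ordLin_rightHom (w : Fq a) (f : MvPolynomial (Fin 4) ℂ) :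
    ordLin a ((rightHom a w).unop f) = ordLin a f * w := by
  induction w using induction generalizing f with
  | hC c => simp [Algebra.algebraMap_eq_smul_one]
  | hg g => rw [rightHom, lift_gen, ordLin_right]
  | hm p q hp hq => rw [map_mul, MulOpposite.unop_mul, Module.End.mul_apply, hq, hp, mul_assoc]
  | hp p q hp hq => simp only [map_add, MulOpposite.unop_add, LinearMap.add_apply, hp, hq, mul_add]

open MvPolynomial in
lemma rightHom_ordMon (p q r s : ℕ) :
    (rightHom a (mu a ^ p * x a ^ q * t a ^ r * v a ^ s)).unop 1 =
      X 0 ^ p * X 1 ^ q * X 2 ^ r * X 3 ^ s := by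
  simp only [map_mul, map_pow, MulOpposite.unop_mul, MulOpposite.unop_pow, Module.End.mul_apply,
    rightHom, lift_gen]
  have h0 : ((rightGen a Gen.mu).unop ^ p) 1 = X 0 ^ p := by
    induction p with
    | zero => simp
    | succ p ih =>
      rw [pow_succ', Module.End.mul_apply, ih, pow_succ']
      simp [rightGen, pderiv_pow, pderiv_X]
  have h1 : ((rightGen a Gen.x).unop ^ q) (X 0 ^ p) = X 0 ^ p * X 1 ^ q := by
    induction q with
    | zero => simp
    | succ q ih =>
      rw [pow_succ', Module.End.mul_apply, ih]
      simp [rightGen, pderiv_mul, pderiv_pow, pderiv_X]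
      ring
  have h2 : ((rightGen a Gen.t).unop ^ r) (X 0 ^ p * X 1 ^ q) = X 0 ^ p * X 1 ^ q * X 2 ^ r := by
    induction r with
    | zero => simp
    | succ r ih =>
      rw [pow_succ', Module.End.mul_apply, ih]
      simp [rightGen]
      ring
  have h3 : ((rightGen a Gen.v).unop ^ s) (X 0 ^ p * X 1 ^ q * X 2 ^ r) =
      X 0 ^ p * X 1 ^ q * X 2 ^ r * X 3 ^ s := by
    induction s with
    | zero => simp
    | succ s ih =>
      rw [pow_succ', Module.End.mul_apply, ih]
      simp [rightGen]
      ring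
  rw [h0, h1, h2, h3]

/-- Normal ordering: the monomials `μ^p x^q t^r v^s` form a basis of `F_q`, so that `F_q` is
identified, as a vector space, with the polynomials in four commuting variables. -/
def normalOrder (a : ℂ) : MvPolynomial (Fin 4) ℂ ≃ₗ[ℂ] Fq a :=
  LinearEquiv.ofLinearMap (ordLin a)
    { toFun := fun w => (rightHom a w).unop 1
      map_add' := by simp
      map_smul' := by simp }
    (by
      ext w
      simp only [LinearMap.comp_apply, LinearMap.coe_mk, AddHom.coe_mk, LinearMap.id_apply]
      rw [ordLin_rightHom]
      have := ordLin_mon4 (a := a) 0 0 0 0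
      simp only [pow_zero, mul_one] at this
      rw [this, one_mul])
    (by
      refine LinearMap.ext fun f => ?_
      simp only [LinearMap.comp_apply, LinearMap.coe_mk, AddHom.coe_mk, LinearMap.id_apply]
      induction f using mon4_induction with
      | h p q r s => rw [ordLin_mon4, rightHom_ordMon]
      | hp f g hf hg => simp only [map_add, MulOpposite.unop_add, LinearMap.add_apply, hf, hg]
      | hc c f hf => simp only [map_smul, MulOpposite.unop_smul, LinearMap.smul_apply, hf])

@[simp] lemma normalOrder_monomial (m : Fin 4 →₀ ℕ) (c : ℂ) :
    normalOrder a (MvPolynomial.monomial m c) = c • ordMon a m :=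
  ordLin_monomial m c

end Fq

/-! ### Differential operators on `F_q` -/

section SeriesOp

variable {V : Type*} [AddCommGroup V] [Module ℂ V]

/-- A locally nilpotent endomorphism. -/
def LocNil (T : Module.End ℂ V) : Prop := ∀ f, ∃ n : ℕ, (T ^ n) f = 0

lemma LocNil.finite_support {T : Module.End ℂ V} (hT : LocNil T) (c : PowerSeries ℂ) (f : V) :
    (Function.support fun n : ℕ => PowerSeries.coeff n c • (T ^ n) f).Finite := by
  obtain ⟨N, hN⟩ := hT f
  refine (Set.finite_Iio N).subset fun n hn => ?_
  by_contra h
  apply hn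
  obtain ⟨k, rfl⟩ := Nat.exists_eq_add_of_le (not_lt.1 h)
  simp only [add_comm N k, pow_add, Module.End.mul_apply, hN, map_zero, smul_zero]

/-- The operator `c(T) = ∑ cₙ Tⁿ` for a power series `c` and a locally nilpotent operator `T`;
the sum is finite on each vector. -/
def seriesOp (c : PowerSeries ℂ) (T : Module.End ℂ V) (hT : LocNil T) : Module.End ℂ V where
  toFun f := ∑ᶠ n : ℕ, PowerSeries.coeff n c • (T ^ n) f
  map_add' f g := by
    simp only [map_add, smul_add]
    exact finsum_add_distrib (hT.finite_support c f) (hT.finite_support c g)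
  map_smul' b f := by
    simp only [map_smul, RingHom.id_apply, smul_comm _ b]
    rw [smul_finsum]

lemma LocNil.smul {T : Module.End ℂ V} (hT : LocNil T) (c : ℂ) : LocNil (c • T) := by
  intro f
  obtain ⟨n, hn⟩ := hT f
  exact ⟨n, by rw [smul_pow, LinearMap.smul_apply, hn, smul_zero]⟩

lemma LocNil.mul_left {T S : Module.End ℂ V} (hT : LocNil T) (h : Commute S T) :
    LocNil (S * T) := by
  intro f
  obtain ⟨n, hn⟩ := hT f
  exact ⟨n, by rw [h.mul_pow, Module.End.mul_apply, hn, map_zero]⟩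

lemma seriesOp_commute {T S : Module.End ℂ V} (hT : LocNil T) (c : PowerSeries ℂ)
    (h : Commute S T) : Commute S (seriesOp c T hT) := by
  refine LinearMap.ext fun f => ?_
  have hn : ∀ n : ℕ, S ((T ^ n) f) = (T ^ n) (S f) := fun n =>
    LinearMap.congr_fun (h.pow_right n) f
  simp only [Module.End.mul_apply, seriesOp, LinearMap.coe_mk, AddHom.coe_mk]
  rw [map_finsum S (hT.finite_support c f)]
  simp only [map_smul, hn]

end SeriesOp

lemma pderiv_locNil (i : Fin 4) :
    LocNil ((MvPolynomial.pderiv i).toLinearMap : Module.End ℂ (MvPolynomial (Fin 4) ℂ)) := by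
  intro f
  induction f using MvPolynomial.induction_on' with
  | monomial m c =>
    have key : ∀ (n : ℕ) (m : Fin 4 →₀ ℕ) (c : ℂ), m i < n →
        (((MvPolynomial.pderiv i).toLinearMap : Module.End ℂ (MvPolynomial (Fin 4) ℂ)) ^ n)
          (MvPolynomial.monomial m c) = 0 := by
      intro n
      induction n with
      | zero => intro m c h; omega
      | succ n ih =>
        intro m c h
        rw [pow_succ, Module.End.mul_apply, Derivation.coeFn_coe, MvPolynomial.pderiv_monomial]
        by_cases h0 : m i = 0
        · simp [h0]
        · apply ih
          simp
          omega
    exact ⟨_, key _ m c (Nat.lt_succ_self _)⟩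
  | add p q hp hq =>
    obtain ⟨n, hn⟩ := hp
    obtain ⟨k, hk⟩ := hq
    refine ⟨n + k, ?_⟩
    have h1 := LinearMap.congr_fun (pow_add ((MvPolynomial.pderiv i).toLinearMap :
      Module.End ℂ (MvPolynomial (Fin 4) ℂ)) n k) q
    have h2 := LinearMap.congr_fun (pow_add ((MvPolynomial.pderiv i).toLinearMap :
      Module.End ℂ (MvPolynomial (Fin 4) ℂ)) k n) p
    rw [Module.End.mul_apply, hk, map_zero] at h1
    rw [Module.End.mul_apply, hn, map_zero, add_comm k n] at h2
    rw [map_add, h1, h2, add_zero]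

lemma pderiv_commute (i j : Fin 4) :
    Commute ((MvPolynomial.pderiv i).toLinearMap : Module.End ℂ (MvPolynomial (Fin 4) ℂ))
      (MvPolynomial.pderiv j).toLinearMap := by
  let D (i : Fin 4) : Derivation ℂ (MvPolynomial (Fin 4) ℂ) (MvPolynomial (Fin 4) ℂ) :=
    MvPolynomial.pderiv i
  have h : ⁅D i, D j⁆ = 0 := by
    apply MvPolynomial.derivation_ext
    intro k
    rw [Derivation.commutator_apply]
    simp only [D, MvPolynomial.pderiv_X, Pi.single_apply]
    split_ifs <;> simp
  refine LinearMap.ext fun f => ?_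
  have := DFunLike.congr_fun h f
  rw [Derivation.commutator_apply] at this
  exact sub_eq_zero.1 this

namespace Fq

variable (a : ℂ)

/-- The partial derivative in the `i`-th of the variables `μ, x, t, v`, on normally ordered
polynomials. -/
def pd (i : Fin 4) : Module.End ℂ (Fq a) :=
  (normalOrder a).conj (MvPolynomial.pderiv i).toLinearMap

/-- The multiplication by the `i`-th of the variables `μ, x, t, v`, on normally ordered
polynomials: it raises the exponent of that variable by one. -/
def bar (i : Fin 4) : Module.End ℂ (Fq a) :=
  (normalOrder a).conj (LinearMap.mulLeft ℂ (MvPolynomial.X i))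

lemma conj_mul (S T : Module.End ℂ (MvPolynomial (Fin 4) ℂ)) :
    (normalOrder a).conj (S * T) = (normalOrder a).conj S * (normalOrder a).conj T :=
  LinearEquiv.conj_comp _ _ _

lemma pd_locNil (i : Fin 4) : LocNil (pd a i) := by
  intro f
  obtain ⟨n, hn⟩ := pderiv_locNil i ((normalOrder a).symm f)
  refine ⟨n, ?_⟩
  have : ∀ k : ℕ, (pd a i) ^ k = (normalOrder a).conj ((MvPolynomial.pderiv i).toLinearMap ^ k) := by
    intro k
    induction k with
    | zero => exact (LinearEquiv.conj_id _).symm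
    | succ k ih => rw [pow_succ, ih, pow_succ, conj_mul, pd]
  rw [this, LinearEquiv.conj_apply_apply, hn, map_zero]

lemma pd_commute (i j : Fin 4) : Commute (pd a i) (pd a j) := by
  unfold Commute SemiconjBy pd
  rw [← conj_mul, ← conj_mul, (pderiv_commute i j).eq]

lemma bar_pd_commute {i j : Fin 4} (h : i ≠ j) : Commute (bar a i) (pd a j) := by
  unfold Commute SemiconjBy pd bar
  rw [← conj_mul, ← conj_mul]
  congr 1
  refine LinearMap.ext fun f => ?_
  simp [MvPolynomial.pderiv_X_of_ne h]

/-- The operator `e^{-2a ∂/∂x}`. -/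
def shiftOp : Module.End ℂ (Fq a) :=
  seriesOp (PowerSeries.exp ℂ) ((-2 * a) • pd a 1) ((pd_locNil a 1).smul _)

lemma commute_shiftOp {S : Module.End ℂ (Fq a)} (h : Commute S (pd a 1)) :
    Commute S (shiftOp a) :=
  seriesOp_commute _ _ (h.smul_right _)

/-- The operator `a v̄ (∂/∂μ) e^{-2a ∂/∂x}`. -/
def tOp : Module.End ℂ (Fq a) := a • (bar a 3 * pd a 0 * shiftOp a)

lemma tOp_locNil : LocNil (tOp a) := by
  unfold tOp
  have h1 : Commute (pd a 0) (shiftOp a) := commute_shiftOp a (pd_commute a 0 1)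
  have h2 : bar a 3 * pd a 0 * shiftOp a = (bar a 3 * shiftOp a) * pd a 0 := by
    rw [mul_assoc, mul_assoc, h1.eq]
  rw [h2]
  exact ((pd_locNil a 0).mul_left
    ((bar_pd_commute a (by decide)).mul_left h1.symm)).smul _

/-! ### The dual algebra -/

/-- The algebra of all linear forms on `F_q`, with the convolution product
`(h k)(f) = h(f₁) k(f₂)` dual to the coproduct. -/
abbrev FullDual : Type := WithConv (Fq a →ₗ[ℂ] ℂ)

/-- The linear form giving the coefficient of the `i`-th of `μ, x, t, v` in the expansion in
normally ordered monomials. -/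
def dualGen (i : Fin 4) : FullDual a :=
  .toConv (MvPolynomial.lcoeff ℂ (Finsupp.single i 1) ∘ₗ (normalOrder a).symm.toLinearMap)

/-- The linear form `e^{cP}`: it takes the value `c ^ q` at `x ^ q`, and vanishes at the other
normally ordered monomials. -/
def expP (c : ℂ) : FullDual a :=
  .toConv ((MvPolynomial.aeval ![0, c, 0, 0] : MvPolynomial (Fin 4) ℂ →ₐ[ℂ] ℂ).toLinearMap ∘ₗ
    (normalOrder a).symm.toLinearMap)

end Fq

open Fq

/-- The quantum extended Galilei algebra `U_q`, generated inside the dual of `F_q` by `I, P, H, N`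
and `e^{aP}`, `e^{-aP}`. -/
def Uq (a : ℂ) : Subalgebra ℂ (FullDual a) :=
  Algebra.adjoin ℂ {dualGen a 0, dualGen a 1, dualGen a 2, dualGen a 3, expP a a, expP a (-a)}

namespace Uq

variable (a : ℂ)

/-- The generator `I`, dual to `μ`. -/
def I : Uq a := ⟨dualGen a 0, Algebra.subset_adjoin (by simp)⟩
/-- The generator `P`, dual to `x`. -/
def P : Uq a := ⟨dualGen a 1, Algebra.subset_adjoin (by simp)⟩
/-- The generator `H`, dual to `t`. -/
def H : Uq a := ⟨dualGen a 2, Algebra.subset_adjoin (by simp)⟩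
/-- The generator `N`, dual to `v`. -/
def N : Uq a := ⟨dualGen a 3, Algebra.subset_adjoin (by simp)⟩
/-- The element `e^{aP}`. -/
def E : Uq a := ⟨expP a a, Algebra.subset_adjoin (by simp)⟩
/-- The element `e^{-aP}`. -/
def E' : Uq a := ⟨expP a (-a), Algebra.subset_adjoin (by simp)⟩

/-- The pairing of `U_q` and `F_q`. -/
def pair {a : ℂ} (h : Uq a) (f : Fq a) : ℂ := (h : FullDual a) f

/-- The left regular action `h ≻ f = f₁ ⟨h, f₂⟩`. -/
def leftAct {a : ℂ} (h : Uq a) : Module.End ℂ (Fq a) :=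
  (TensorProduct.rid ℂ (Fq a)).toLinearMap ∘ₗ (h : FullDual a).ofConv.lTensor (Fq a) ∘ₗ
    Coalgebra.comul

/-- The right regular action `f ≺ h = ⟨h, f₁⟩ f₂`. -/
def rightAct {a : ℂ} (h : Uq a) : Module.End ℂ (Fq a) :=
  (TensorProduct.lid ℂ (Fq a)).toLinearMap ∘ₗ (h : FullDual a).ofConv.rTensor (Fq a) ∘ₗ
    Coalgebra.comul

/-- The Abelian subalgebra generated by `I, P, H` (with `e^{aP}`, `e^{-aP}`). -/
def K : Subalgebra ℂ (Uq a) := Algebra.adjoin ℂ {I a, P a, H a, E a, E' a}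

/-- `I` as an element of the Abelian subalgebra. -/
def kI : K a := ⟨I a, Algebra.subset_adjoin (by simp)⟩
/-- `P` as an element of the Abelian subalgebra. -/
def kP : K a := ⟨P a, Algebra.subset_adjoin (by simp)⟩
/-- `H` as an element of the Abelian subalgebra. -/
def kH : K a := ⟨H a, Algebra.subset_adjoin (by simp)⟩
/-- `e^{aP}` as an element of the Abelian subalgebra. -/
def kE : K a := ⟨E a, Algebra.subset_adjoin (by simp)⟩
/-- `e^{-aP}` as an element of the Abelian subalgebra. -/
def kE' : K a := ⟨E' a, Algebra.subset_adjoin (by simp)⟩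

variable {a}

/-- The character `I^p P^q H^r ⊢ 1 = α^p β^q γ^r`, with `e^{±aP} ⊢ 1 = e^{±aβ}`. -/
def IsCharacter (α β γ : ℂ) (χ : K a →ₐ[ℂ] ℂ) : Prop :=
  (∀ p q r : ℕ, χ (kI a ^ p * kP a ^ q * kH a ^ r) = α ^ p * β ^ q * γ ^ r) ∧
    χ (kE a) = Complex.exp (a * β) ∧ χ (kE' a) = Complex.exp (-(a * β))

/-- The carrier space `Hom_K(U_q, ℂ)` of the representation coinduced by a character `χ` of the
Abelian subalgebra `K`. -/
def coinduced (χ : K a →ₐ[ℂ] ℂ) : Submodule ℂ (Uq a →ₗ[ℂ] ℂ) where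
  carrier := {F | ∀ (k : K a) (h : Uq a), F ((k : Uq a) * h) = χ k * F h}
  add_mem' hF hG k h := by simp [hF k h, hG k h, mul_add]
  zero_mem' k h := by simp
  smul_mem' c F hF k h := by simp [hF k h, mul_left_comm]

/-- The representation of `U_q` coinduced by the character `χ`: `(h ▷ F)(h') = F(h' h)`. -/
def coinducedRep (χ : K a →ₐ[ℂ] ℂ) : Uq a →ₐ[ℂ] Module.End ℂ (coinduced χ) :=
  AlgHom.ofLinearMap
    { toFun := fun h =>
        { toFun := fun F => ⟨(F : Uq a →ₗ[ℂ] ℂ) ∘ₗ LinearMap.mulRight ℂ h, fun k h' => by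
            simpa [mul_assoc] using F.2 k (h' * h)⟩
          map_add' := fun F G => by ext; simp
          map_smul' := fun c F => by ext; simp }
      map_add' := fun h h' => by
        refine LinearMap.ext fun F => Subtype.ext (LinearMap.ext fun u => ?_)
        simp [mul_add]
      map_smul' := fun c h => by
        refine LinearMap.ext fun F => Subtype.ext (LinearMap.ext fun u => ?_)
        simp }
    (by
      refine LinearMap.ext fun F => Subtype.ext (LinearMap.ext fun u => ?_)
      simp)
    (fun h h' => by
      refine LinearMap.ext fun F => Subtype.ext (LinearMap.ext fun u => ?_)
      simp [mul_assoc])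

/-! ### Formal series in `μ, x, t, v`

A formal series `∑ f_m μ^{m 0} x^{m 1} t^{m 2} v^{m 3}` in the normally ordered monomials is
represented by the power series with the coefficients `f_m`. -/

/-- The terms of the pairing of `h` with a formal series. -/
def pairTerm (h : Uq a) (f : MvPowerSeries (Fin 4) ℂ) (m : Fin 4 →₀ ℕ) : ℂ :=
  MvPowerSeries.coeff m f * pair h (ordMon a m)

/-- The formal series `f` pairs with all of `U_q` and satisfies the equivariance condition
`⟨f, k h⟩ = χ(k) ⟨f, h⟩`. -/
def IsEquivariant (χ : K a →ₐ[ℂ] ℂ) (f : MvPowerSeries (Fin 4) ℂ) : Prop :=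
  (∀ h : Uq a, Summable (pairTerm h f)) ∧
    ∀ (k : K a) (h : Uq a), ∑' m, pairTerm ((k : Uq a) * h) f m = χ k * ∑' m, pairTerm h f m

/-- The formal series `e^{αμ} e^{βx} e^{γt} φ(v)`. -/
def expSeries (α β γ : ℂ) (φ : PowerSeries ℂ) : MvPowerSeries (Fin 4) ℂ := fun m =>
  α ^ m 0 / (m 0).factorial * (β ^ m 1 / (m 1).factorial) * (γ ^ m 2 / (m 2).factorial) *
    PowerSeries.coeff (m 3) φ

end Uq

end QGalilei

end

open QGalilei QGalilei.Fq QGalilei.Uq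

/-!
Everything on the side of `F_q` follows from one principle (`end_ext`): an operator on `F_q` is
determined by its value at `1` and by its recursion under the right multiplications `R_g` by the
generators `g`. Normal ordering gives these recursions for the partial derivatives, for the shifts
`e^{c∂_x}`, and for `T = a v̄ ∂_μ e^{-2a∂_x}`, which commutes with `R_x`, `R_t`, `R_v` and satisfies
`[T, R_μ] = a v̄ (1 + T)` (`tOp_mul_mu`). Since `a v̄ (1 + T)` commutes with `T`, a power series
`c(T)` satisfies `[c(T), R_μ] = a v̄ (1 + T) c'(T)` (`seriesOp_tOp_mul_mu`).

As linear forms, `I`, `P`, `H`, `N` are `ε ∘ ∂_i` and `e^{cP}` is `ε ∘ e^{c∂_x}`. They obey the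
product rules `ΔI = I ⊗ 1 + e^{2aP} ⊗ I`, `ΔP = P ⊗ 1 + 1 ⊗ P`, `ΔH = H ⊗ 1 + 1 ⊗ H`,
`ΔN = N ⊗ e^{-2aP} + 1 ⊗ N`, and their regular actions on `F_q` obey the same rules (`lact_mul`,
`ract_mul`). This gives recursions for the actions, which are those of the asserted differential
operators: in the left action of `P` the logarithm arises because `c = log (1 + X)` solves
`(1 + X) c' = 1`, and in that of `H` the factor `(1 + T)⁻¹` because `c = (1 + X)⁻¹` solves
`(1 + X) c' = -c`.

A product in `U_q` pairs with `f` by applying the right actions of its factors to `f` in turn and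
then the counit. So the commutation relations of `U_q` are those of differential operators. They
show that `[N, K] ⊆ K`, whence `U_q` is spanned by the products `k N ^ s` with `k ∈ K`
(`mem_spanKN`).

Left multiplication by `I`, `P` or `H` multiplies the pairings with `e^{αμ} e^{βx} e^{γt} φ(v)` by
`α`, `β` or `γ`, by a reindexing of the sum. For `e^{±aP}` the factor is `e^{±aβ}`: the double
series over the exponential and the monomials converges absolutely (`hasSum_pairTerm_exp_mul`). As the
pairing with `N ^ s` is a single term, all these pairings converge, and the factors by which the
elements of `K` act form the character `χ`. Conversely, an equivariant series is determined by its
pairings with the powers of `N`, as these and `χ` give its pairings with `I^p P^q H^r N^s`, which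
are its coefficients up to factorials.

An element of the coinduced space is likewise determined by its values at the powers of `N`, and
these values may be prescribed freely, so the space is isomorphic to `ℂ[[v]]` (`coinducedEquiv`).
There `N` acts by `d/dv`, and `[N, K] ⊆ K` forces each `k ∈ K` to act by the multiplication by a
series `g_k` with constant term `χ(k)` and `g_k' = g_{[N, k]}` (`rho_apply`). These equations are
solved as follows: `e^{-2aP} I²` is central, so its series is constant, which makes `g_I` affine;
then `[N, e^{2aP}] = 2a I` gives `g` at `e^{±2aP}`, and `g_P` and `g_H` follow by integration.
-/

namespace QGalilei

/-! ### Power series in a locally nilpotent operator -/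

section SeriesOp

variable {V : Type*} [AddCommGroup V] [Module ℂ V]

lemma seriesOp_apply_eq_sum (c : PowerSeries ℂ) {T : Module.End ℂ V} (hT : LocNil T) {f : V}
    {n : ℕ} (hn : (T ^ n) f = 0) :
    seriesOp c T hT f = ∑ k ∈ Finset.range n, PowerSeries.coeff k c • (T ^ k) f := by
  refine finsum_eq_sum_of_support_subset _ fun k hk => ?_
  simp only [Finset.coe_range, Set.mem_Iio]
  by_contra h
  apply hk
  obtain ⟨j, rfl⟩ := Nat.exists_eq_add_of_le (not_lt.1 h)
  simp only [add_comm n j, pow_add, Module.End.mul_apply, hn, map_zero, smul_zero]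

lemma pow_apply_eq_zero_of_le {T : Module.End ℂ V} {f : V} {n m : ℕ} (hn : (T ^ n) f = 0)
    (h : n ≤ m) : (T ^ m) f = 0 := by
  obtain ⟨j, rfl⟩ := Nat.exists_eq_add_of_le h
  rw [add_comm, pow_add, Module.End.mul_apply, hn, map_zero]

/-- On a given vector a power series in a locally nilpotent operator is a truncated polynomial. -/
lemma seriesOp_apply_eq_aeval (c : PowerSeries ℂ) {T : Module.End ℂ V} (hT : LocNil T) {f : V}
    {n : ℕ} (hn : (T ^ n) f = 0) :
    seriesOp c T hT f = Polynomial.aeval T (PowerSeries.trunc n c) f := by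
  rw [seriesOp_apply_eq_sum c hT hn, Polynomial.aeval_def, PowerSeries.eval₂_trunc_eq_sum_range,
    LinearMap.sum_apply]
  simp [Algebra.algebraMap_eq_smul_one]

lemma hasSum_seriesOp (ℓ : V →ₗ[ℂ] ℂ) (c : PowerSeries ℂ) {T : Module.End ℂ V} (hT : LocNil T)
    (f : V) :
    HasSum (fun n : ℕ => PowerSeries.coeff n c * ℓ ((T ^ n) f)) (ℓ (seriesOp c T hT f)) := by
  obtain ⟨n, hn⟩ := hT f
  rw [seriesOp_apply_eq_sum c hT hn, map_sum]
  simp only [map_smul, smul_eq_mul]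
  refine hasSum_sum_of_ne_finset_zero fun k hk => ?_
  rw [pow_apply_eq_zero_of_le hn (by simpa using hk), map_zero, mul_zero]

lemma seriesOp_one {T : Module.End ℂ V} (hT : LocNil T) : seriesOp 1 T hT = 1 := by
  refine LinearMap.ext fun f => ?_
  obtain ⟨n, hn⟩ := hT f
  rw [seriesOp_apply_eq_sum _ hT (pow_apply_eq_zero_of_le hn n.le_succ), Finset.sum_range_succ']
  simp [PowerSeries.coeff_one]

lemma seriesOp_X {T : Module.End ℂ V} (hT : LocNil T) : seriesOp PowerSeries.X T hT = T := by
  refine LinearMap.ext fun f => ?_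
  obtain ⟨n, hn⟩ := hT f
  rw [seriesOp_apply_eq_sum _ hT (pow_apply_eq_zero_of_le hn (n.le_add_right 2)),
    Finset.sum_eq_single 1] <;> simp +contextual [PowerSeries.coeff_X]

lemma seriesOp_add (c d : PowerSeries ℂ) {T : Module.End ℂ V} (hT : LocNil T) :
    seriesOp (c + d) T hT = seriesOp c T hT + seriesOp d T hT := by
  refine LinearMap.ext fun f => ?_
  obtain ⟨n, hn⟩ := hT f
  simp [seriesOp_apply_eq_sum _ hT hn, add_smul, Finset.sum_add_distrib]

lemma seriesOp_neg (c : PowerSeries ℂ) {T : Module.End ℂ V} (hT : LocNil T) :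
    seriesOp (-c) T hT = -seriesOp c T hT := by
  refine LinearMap.ext fun f => ?_
  obtain ⟨n, hn⟩ := hT f
  simp [seriesOp_apply_eq_sum _ hT hn]

lemma seriesOp_mul (c d : PowerSeries ℂ) {T : Module.End ℂ V} (hT : LocNil T) :
    seriesOp (c * d) T hT = seriesOp c T hT * seriesOp d T hT := by
  refine LinearMap.ext fun f => ?_
  obtain ⟨n, hn⟩ := hT f
  have hd : (T ^ n) (seriesOp d T hT f) = 0 := by
    have h := LinearMap.congr_fun (seriesOp_commute hT d ((Commute.refl T).pow_left n)).eq f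
    rw [Module.End.mul_apply, Module.End.mul_apply, hn, map_zero] at h
    exact h
  -- A single truncation order serves for the two factors and for their product.
  have hsum : ∀ p : Polynomial ℂ, Polynomial.aeval T p f =
      ∑ k ∈ Finset.range n, p.coeff k • (T ^ k) f := by
    intro p
    rw [Polynomial.aeval_eq_sum_range' (n := n + p.natDegree + 1) (by omega), LinearMap.sum_apply]
    symm
    refine Finset.sum_subset (fun k => by simp; omega) fun k _ hk => ?_
    rw [pow_apply_eq_zero_of_le hn (by simpa using hk), smul_zero]
  rw [Module.End.mul_apply, seriesOp_apply_eq_aeval c hT hd, seriesOp_apply_eq_aeval d hT hn,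
    ← Module.End.mul_apply, ← map_mul, seriesOp_apply_eq_sum _ hT hn, hsum]
  refine Finset.sum_congr rfl fun k hk => ?_
  rw [← Polynomial.coeff_coe, Polynomial.coe_mul,
    PowerSeries.coeff_mul_eq_coeff_trunc_mul_trunc _ _ (Finset.mem_range.1 hk)]

/-- If `[T, R] = B` commutes with `T`, then `[c(T), R] = B c'(T)`. This is what turns a recursion of
`T` under a multiplication `R` into recursions of `log (1 + T)` and `(1 + T)⁻¹`. -/
lemma seriesOp_comm_of_comm (c : PowerSeries ℂ) {T : Module.End ℂ V} (hT : LocNil T)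
    {R B : Module.End ℂ V} (h : T * R = R * T + B) (hB : Commute T B) :
    seriesOp c T hT * R = R * seriesOp c T hT + B * seriesOp (PowerSeries.derivative ℂ c) T hT := by
  have hpow : ∀ n : ℕ, T ^ (n + 1) * R = R * T ^ (n + 1) + ((n : ℂ) + 1) • (B * T ^ n) := by
    intro n
    induction n with
    | zero => simpa using h
    | succ n ih =>
      rw [pow_succ' T (n + 1), mul_assoc, ih, mul_add, ← mul_assoc, h, mul_smul_comm,
        ← mul_assoc T B, hB.eq, mul_assoc B T, ← pow_succ', add_mul, mul_assoc]
      push_cast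
      module
  refine LinearMap.ext fun f => ?_
  obtain ⟨n, hn⟩ := hT f
  obtain ⟨m, hm⟩ := hT (R f)
  have h1 : (T ^ (n + m)) f = 0 := pow_apply_eq_zero_of_le hn (by omega)
  have h1' : (T ^ (n + m + 1)) f = 0 := pow_apply_eq_zero_of_le hn (by omega)
  have h2 : (T ^ (n + m + 1)) (R f) = 0 := pow_apply_eq_zero_of_le hm (by omega)
  simp only [Module.End.mul_apply, LinearMap.add_apply]
  rw [seriesOp_apply_eq_sum c hT h2, seriesOp_apply_eq_sum c hT h1', seriesOp_apply_eq_sum _ hT h1,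
    map_sum, map_sum, Finset.sum_range_succ', Finset.sum_range_succ' _ (n + m), add_right_comm,
    ← Finset.sum_add_distrib]
  congr 1
  · refine Finset.sum_congr rfl fun k _ => ?_
    have := LinearMap.congr_fun (hpow k) f
    simp only [Module.End.mul_apply, LinearMap.add_apply, LinearMap.smul_apply] at this
    rw [this, PowerSeries.coeff_derivative, map_smul, map_smul, smul_add, smul_smul]
  · simp

end SeriesOp
end QGalilei

noncomputable section
namespace QGalilei
namespace Fq

variable {a : ℂ}

/-! ### Leibniz rules for the multiplications by the generators of `F_q` -/

lemma right_induction {Q : Fq a → Prop} (h1 : Q 1) (hadd : ∀ f g, Q f → Q g → Q (f + g))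
    (hsmul : ∀ (c : ℂ) f, Q f → Q (c • f)) (hgen : ∀ f g, Q f → Q (f * gen a g)) (f : Fq a) :
    Q f := by
  suffices h : ∀ w f : Fq a, Q f → Q (f * w) by simpa using h f 1 h1
  intro w
  induction w using Fq.induction with
  | hC c => intro f hf; rw [← Algebra.commutes, ← Algebra.smul_def]; exact hsmul c f hf
  | hg g => exact fun f hf => hgen f g hf
  | hm p q hp hq => intro f hf; rw [← mul_assoc]; exact hq _ (hp _ hf)
  | hp p q hp hq => intro f hf; rw [mul_add]; exact hadd _ _ (hp _ hf) (hq _ hf)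

/-- Two operators on `F_q` agree once they agree at `1` and obey the same recursion for the right
multiplications by the generators. -/
lemma end_ext {A B : Module.End ℂ (Fq a)} (h1 : A 1 = B 1)
    (hgen : ∀ f g, A f = B f → A (f * gen a g) = B (f * gen a g)) : A = B := by
  refine LinearMap.ext fun f => ?_
  induction f using right_induction with
  | h1 => exact h1
  | hadd f g hf hg => rw [map_add, map_add, hf, hg]
  | hsmul c f hf => rw [map_smul, map_smul, hf]
  | hgen f g hf => exact hgen f g hf

lemma normalOrder_one : normalOrder a 1 = 1 := by
  have h : ordLin a (MvPolynomial.X 0 ^ 0 * MvPolynomial.X 1 ^ 0 * MvPolynomial.X 2 ^ 0 *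
      MvPolynomial.X 3 ^ 0) = _ := ordLin_mon4 0 0 0 0
  simp only [pow_zero, mul_one] at h
  exact h

lemma normalOrder_mul_gen (φ : MvPolynomial (Fin 4) ℂ) (g : Gen) :
    normalOrder a φ * gen a g = normalOrder a ((rightGen a g).unop φ) :=
  (ordLin_right g φ).symm

lemma pd_normalOrder (i : Fin 4) (φ : MvPolynomial (Fin 4) ℂ) :
    pd a i (normalOrder a φ) = normalOrder a (MvPolynomial.pderiv i φ) := by
  rw [pd, LinearEquiv.conj_apply_apply, LinearEquiv.symm_apply_apply]
  rfl

lemma bar_normalOrder (i : Fin 4) (φ : MvPolynomial (Fin 4) ℂ) :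
    bar a i (normalOrder a φ) = normalOrder a (MvPolynomial.X i * φ) := by
  rw [bar, LinearEquiv.conj_apply_apply, LinearEquiv.symm_apply_apply]
  rfl

@[simp] lemma pd_one (i : Fin 4) : pd a i 1 = 0 := by
  rw [← normalOrder_one, pd_normalOrder]; simp

variable (a) in
/-- The operator `e^{c ∂/∂x}`, which replaces `x` by `x + c` in normally ordered polynomials. -/
def shift (c : ℂ) : Module.End ℂ (Fq a) :=
  seriesOp (PowerSeries.exp ℂ) (c • pd a 1) ((pd_locNil a 1).smul c)

lemma shiftOp_eq : shiftOp a = shift a (-2 * a) := rfl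

lemma commute_shift {S : Module.End ℂ (Fq a)} (h : Commute S (pd a 1)) (c : ℂ) :
    Commute S (shift a c) :=
  seriesOp_commute _ _ (h.smul_right _)

lemma pd_pd (i j : Fin 4) (f : Fq a) : pd a i (pd a j f) = pd a j (pd a i f) :=
  LinearMap.congr_fun (pd_commute a i j).eq f

lemma pd_shift (i : Fin 4) (c : ℂ) (f : Fq a) : pd a i (shift a c f) = shift a c (pd a i f) :=
  LinearMap.congr_fun (commute_shift (pd_commute a i 1) c).eq f

lemma pd_bar_of_ne {i j : Fin 4} (h : j ≠ i) (f : Fq a) :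
    pd a i (bar a j f) = bar a j (pd a i f) :=
  (LinearMap.congr_fun (bar_pd_commute a h).eq f).symm

lemma pd_bar_self (i : Fin 4) (f : Fq a) : pd a i (bar a i f) = bar a i (pd a i f) + f := by
  obtain ⟨φ, rfl⟩ := (normalOrder a).surjective f
  simp only [bar_normalOrder, pd_normalOrder, ← map_add]
  simp

lemma shift_bar_of_ne {j : Fin 4} (h : j ≠ 1) (c : ℂ) (f : Fq a) :
    shift a c (bar a j f) = bar a j (shift a c f) :=
  (LinearMap.congr_fun (commute_shift (bar_pd_commute a h) c).eq f).symm

@[simp] lemma derivative_exp' : PowerSeries.derivative ℂ (PowerSeries.exp ℂ) = PowerSeries.exp ℂ :=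
  PowerSeries.derivative_exp ℂ

/-- A first-order recursion for `∂/∂x` integrates to one for `e^{c ∂/∂x}`. -/
lemma shift_of_pd {R B : Module.End ℂ (Fq a)} (h : pd a 1 * R = R * pd a 1 + B)
    (hB : Commute (pd a 1) B) (c : ℂ) (f : Fq a) :
    shift a c (R f) = R (shift a c f) + c • B (shift a c f) := by
  have := seriesOp_comm_of_comm (PowerSeries.exp ℂ) ((pd_locNil a 1).smul c) (R := R) (B := c • B)
    (by rw [smul_mul_assoc, h, smul_add, mul_smul_comm]) ((hB.smul_left c).smul_right c)
  rw [derivative_exp'] at this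
  exact LinearMap.congr_fun this f

lemma shift_bar_x (c : ℂ) (f : Fq a) :
    shift a c (bar a 1 f) = bar a 1 (shift a c f) + c • shift a c f :=
  shift_of_pd (R := bar a 1) (B := 1) (LinearMap.ext fun f => pd_bar_self 1 f)
    (Commute.one_right _) c f

@[simp] lemma shift_one (c : ℂ) : shift a c 1 = 1 := by
  have : ((c • pd a 1) ^ 1) (1 : Fq a) = 0 := by simp
  rw [shift, seriesOp_apply_eq_sum _ _ this]
  simp

/-- The substitution `x ↦ x + c` of polynomials. -/
def shiftPoly (c : ℂ) : MvPolynomial (Fin 4) ℂ →ₐ[ℂ] MvPolynomial (Fin 4) ℂ :=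
  MvPolynomial.bind₁ ![MvPolynomial.X 0, MvPolynomial.X 1 + MvPolynomial.C c, MvPolynomial.X 2,
    MvPolynomial.X 3]

lemma shiftPoly_X (c : ℂ) (i : Fin 4) :
    shiftPoly c (MvPolynomial.X i) = MvPolynomial.X i + if i = 1 then MvPolynomial.C c else 0 := by
  fin_cases i <;> simp [shiftPoly]

lemma shiftPoly_C (c b : ℂ) : shiftPoly c (MvPolynomial.C b) = MvPolynomial.C b := by
  simp [shiftPoly]

lemma shift_normalOrder (c : ℂ) (φ : MvPolynomial (Fin 4) ℂ) :
    shift a c (normalOrder a φ) = normalOrder a (shiftPoly c φ) := by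
  induction φ using MvPolynomial.induction_on with
  | C b =>
    rw [shiftPoly_C, ← mul_one (MvPolynomial.C b), ← MvPolynomial.smul_eq_C_mul]
    simp only [map_smul, normalOrder_one, shift_one]
  | add p q hp hq => simp only [map_add, hp, hq]
  | mul_X p i hp =>
    rw [mul_comm, ← bar_normalOrder, map_mul, shiftPoly_X]
    by_cases hi : i = 1
    · subst hi
      rw [shift_bar_x, hp, bar_normalOrder, ← map_smul, ← map_add, MvPolynomial.smul_eq_C_mul]
      simp [add_mul]
    · rw [shift_bar_of_ne hi, hp, bar_normalOrder, if_neg hi, add_zero]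

section RightMul

variable (φ : MvPolynomial (Fin 4) ℂ)

open MvPolynomial

lemma normalOrder_mul_mu : normalOrder a φ * mu a =
    normalOrder a (X 0 * shiftPoly (2 * a) φ - C a * X 3 ^ 2 * pderiv 3 φ) :=
  normalOrder_mul_gen φ Gen.mu

lemma normalOrder_mul_x : normalOrder a φ * x a =
    normalOrder a (X 1 * φ - C (2 * a) * X 3 * pderiv 3 φ) :=
  normalOrder_mul_gen φ Gen.x

lemma normalOrder_mul_t : normalOrder a φ * t a = normalOrder a (X 2 * φ) :=
  normalOrder_mul_gen φ Gen.t

lemma normalOrder_mul_v : normalOrder a φ * v a = normalOrder a (X 3 * φ) :=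
  normalOrder_mul_gen φ Gen.v

end RightMul

lemma bar_v_eq (f : Fq a) : bar a 3 f = f * v a := by
  obtain ⟨φ, rfl⟩ := (normalOrder a).surjective f
  rw [bar_normalOrder, normalOrder_mul_v]

lemma bar_t_eq (f : Fq a) : bar a 2 f = f * t a := by
  obtain ⟨φ, rfl⟩ := (normalOrder a).surjective f
  rw [bar_normalOrder, normalOrder_mul_t]

/-- Normal ordering of `f x` moves `x` past the powers of `v` in `f`. -/
lemma bar_x_eq (f : Fq a) : bar a 1 f = f * x a + (2 * a) • (pd a 3 f * v a) := by
  obtain ⟨φ, rfl⟩ := (normalOrder a).surjective f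
  rw [bar_normalOrder, pd_normalOrder, normalOrder_mul_v, normalOrder_mul_x, ← map_smul, ← map_add,
    MvPolynomial.smul_eq_C_mul]
  congr 1
  ring

/-- Normal ordering of `f μ` moves `μ` past the powers of `v` and of `x` in `f`; moving it past a
function of `x` shifts the argument by `2a`. -/
lemma bar_mu_shift_eq (f : Fq a) :
    bar a 0 (shift a (2 * a) f) = f * mu a + a • (pd a 3 f * v a * v a) := by
  obtain ⟨φ, rfl⟩ := (normalOrder a).surjective f
  rw [shift_normalOrder, bar_normalOrder, pd_normalOrder, normalOrder_mul_v, normalOrder_mul_v,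
    normalOrder_mul_mu, ← map_smul, ← map_add, MvPolynomial.smul_eq_C_mul]
  congr 1
  ring

lemma pd_mul_v (i : Fin 4) (f : Fq a) :
    pd a i (f * v a) = pd a i f * v a + if i = 3 then f else 0 := by
  rw [← bar_v_eq, ← bar_v_eq]
  split_ifs with h
  · subst h; exact pd_bar_self 3 f
  · rw [add_zero, pd_bar_of_ne (Ne.symm h)]

lemma pd_mul_t (i : Fin 4) (f : Fq a) :
    pd a i (f * t a) = pd a i f * t a + if i = 2 then f else 0 := by
  rw [← bar_t_eq, ← bar_t_eq]
  split_ifs with h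
  · subst h; exact pd_bar_self 2 f
  · rw [add_zero, pd_bar_of_ne (Ne.symm h)]

lemma pd_mul_x (i : Fin 4) (f : Fq a) :
    pd a i (f * x a) = pd a i f * x a + (if i = 1 then f else 0)
      - (if i = 3 then (2 * a) • pd a 3 f else 0) := by
  have h : ∀ f : Fq a, f * x a = bar a 1 f - (2 * a) • (pd a 3 f * v a) := fun f => by
    rw [bar_x_eq, add_sub_cancel_right]
  rw [h, h, map_sub, map_smul, pd_mul_v, pd_pd i 3]
  by_cases h1 : i = 1
  · subst h1
    rw [pd_bar_self]
    simp
    abel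
  · rw [pd_bar_of_ne (Ne.symm h1), if_neg h1]
    by_cases h3 : i = 3
    · simp only [h3, if_true, smul_add]; abel
    · simp only [if_neg h3, add_zero, sub_zero]

lemma pd_mul_mu (i : Fin 4) (f : Fq a) :
    pd a i (f * mu a) = pd a i f * mu a + (if i = 0 then shift a (2 * a) f else 0)
      - (if i = 3 then (2 * a) • (pd a 3 f * v a) else 0) := by
  have h : ∀ f : Fq a, f * mu a = bar a 0 (shift a (2 * a) f) - a • (pd a 3 f * v a * v a) :=
    fun f => by rw [bar_mu_shift_eq, add_sub_cancel_right]
  rw [h, h, map_sub, map_smul, pd_mul_v, pd_mul_v, pd_pd i 3, ← pd_shift]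
  by_cases h1 : i = 0
  · subst h1
    rw [pd_bar_self]
    simp
    abel
  · rw [pd_bar_of_ne (Ne.symm h1), if_neg h1]
    by_cases h3 : i = 3
    · simp only [h3, if_true, add_mul]; module
    · simp only [if_neg h3, add_zero, sub_zero]

lemma shift_mul_v (c : ℂ) (f : Fq a) : shift a c (f * v a) = shift a c f * v a := by
  rw [← bar_v_eq, ← bar_v_eq, shift_bar_of_ne (by decide)]

lemma shift_mul_t (c : ℂ) (f : Fq a) : shift a c (f * t a) = shift a c f * t a := by
  rw [← bar_t_eq, ← bar_t_eq, shift_bar_of_ne (by decide)]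

lemma shift_mul_x (c : ℂ) (f : Fq a) :
    shift a c (f * x a) = shift a c f * x a + c • shift a c f :=
  shift_of_pd (R := LinearMap.mulRight ℂ (x a)) (B := 1)
    (LinearMap.ext fun f => by simp [pd_mul_x]) (Commute.one_right _) c f

lemma shift_mul_mu (c : ℂ) (f : Fq a) : shift a c (f * mu a) = shift a c f * mu a := by
  have := shift_of_pd (R := LinearMap.mulRight ℂ (mu a)) (B := 0)
    (LinearMap.ext fun f => by simp [pd_mul_mu]) (Commute.zero_right _) c f
  simpa using this

/-- Each shift of `x` is an algebra endomorphism of `F_q`. -/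
lemma shift_mul (c : ℂ) (f g : Fq a) : shift a c (f * g) = shift a c f * shift a c g := by
  have hg : ∀ (i : Gen) (f : Fq a),
      shift a c (f * gen a i) = shift a c f * shift a c (gen a i) := by
    intro i f
    have h1 := fun j => congrArg (shift a c) (one_mul (gen a j))
    cases i
    · rw [← h1 .mu, shift_mul_mu, shift_mul_mu, shift_one, one_mul]
    · rw [← h1 .x, shift_mul_x, shift_mul_x, shift_one, one_mul, mul_add, mul_smul_comm, mul_one]
    · rw [← h1 .t, shift_mul_t, shift_mul_t, shift_one, one_mul]
    · rw [← h1 .v, shift_mul_v, shift_mul_v, shift_one, one_mul]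
  induction g using right_induction with
  | h1 => simp
  | hadd g g' h h' => simp only [mul_add, map_add, h, h']
  | hsmul b g h => simp only [mul_smul_comm, map_smul, h]
  | hgen g i h => rw [← mul_assoc, hg, h, hg i g, mul_assoc]

lemma shift_shift (c d : ℂ) (f : Fq a) : shift a c (shift a d f) = shift a (c + d) f := by
  have : shift a c * shift a d = shift a (c + d) := by
    refine end_ext (by simp) fun f g h => ?_
    rw [Module.End.mul_apply] at h ⊢
    cases g
    · simp only [shift_mul_mu, h]
    · simp only [shift_mul_x, map_add, map_smul, h]; module
    · simp only [shift_mul_t, h]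
    · simp only [shift_mul_v, h]
  exact LinearMap.congr_fun this f

@[simp] lemma shift_zero (f : Fq a) : shift a 0 f = f := by
  have : (((0 : ℂ) • pd a 1 : Module.End ℂ (Fq a)) ^ 1) f = 0 := by simp
  rw [shift, seriesOp_apply_eq_sum _ _ this]
  simp

/-- The multiplication by the commuting variable `μ` in terms of right multiplications. -/
lemma bar_mu_eq (f : Fq a) :
    bar a 0 f = shift a (-2 * a) f * mu a + a • (pd a 3 (shift a (-2 * a) f) * v a * v a) := by
  rw [← bar_mu_shift_eq, shift_shift]
  simp

lemma tOp_apply (f : Fq a) : tOp a f = a • (pd a 0 (shift a (-2 * a) f) * v a) := by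
  rw [← bar_v_eq]; rfl

lemma tOp_mul_v (f : Fq a) : tOp a (f * v a) = tOp a f * v a := by
  simp [tOp_apply, shift_mul_v, pd_mul_v]

lemma tOp_mul_t (f : Fq a) : tOp a (f * t a) = tOp a f * t a := by
  simp [tOp_apply, shift_mul_t, pd_mul_t, mul_assoc, v_t]

lemma tOp_mul_x (f : Fq a) : tOp a (f * x a) = tOp a f * x a := by
  simp only [tOp_apply, shift_mul_x, pd_mul_x, map_add, map_smul, add_mul, smul_mul_assoc,
    mul_assoc, v_x, mul_sub, mul_smul_comm, Fin.reduceEq, if_false, add_zero, sub_zero]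
  module

/-- The only nontrivial commutator of `T = a v̄ ∂_μ e^{-2a∂_x}` with a right multiplication by a
generator is `[T, R_μ] = a v̄ (1 + T)`. -/
lemma tOp_mul_mu (f : Fq a) : tOp a (f * mu a) = tOp a f * mu a + a • ((f + tOp a f) * v a) := by
  simp only [tOp_apply, shift_mul_mu, pd_mul_mu, add_mul, smul_mul_assoc,
    mul_assoc, v_mu, mul_sub, mul_smul_comm, shift_shift, pow_two, Fin.reduceEq, if_false, if_true,
    sub_zero, neg_mul, add_neg_cancel, shift_zero]
  module

/-! ### Twisted Leibniz rules -/

/-- `∂_μ` is a skew derivation, since moving `μ` to the left past `f` shifts `x` by `2a` in `f`. -/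
lemma pd_mu_mul (f g : Fq a) : pd a 0 (f * g) = pd a 0 f * g + shift a (2 * a) f * pd a 0 g := by
  induction g using right_induction with
  | h1 => simp
  | hadd g g' h h' => simp only [mul_add, map_add, h, h']; abel
  | hsmul b g h => simp only [mul_smul_comm, map_smul, h, smul_add]
  | hgen g i h =>
    rw [← mul_assoc]
    cases i
    · simp only [pd_mul_mu, h, shift_mul, Fin.reduceEq, if_false, if_true, sub_zero]
      simp only [add_mul, mul_add, mul_assoc, add_assoc]
    · simp only [pd_mul_x, h, Fin.reduceEq, if_false, sub_zero, add_zero]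
      simp only [add_mul, mul_assoc]
    · simp only [pd_mul_t, h, Fin.reduceEq, if_false, add_zero]
      simp only [add_mul, mul_assoc]
    · simp only [pd_mul_v, h, Fin.reduceEq, if_false, add_zero]
      simp only [add_mul, mul_assoc]

lemma pd_mul_of_ne {i : Fin 4} (h0 : i ≠ 0) (h3 : i ≠ 3) (f g : Fq a) :
    pd a i (f * g) = pd a i f * g + f * pd a i g := by
  induction g using right_induction with
  | h1 => simp
  | hadd g g' h h' => simp only [mul_add, map_add, h, h']; abel
  | hsmul b g h => simp only [mul_smul_comm, map_smul, h, smul_add]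
  | hgen g i h =>
    rw [← mul_assoc]
    cases i
    · simp only [pd_mul_mu, h, if_neg h0, if_neg h3, sub_zero, add_zero]
      simp only [add_mul, mul_assoc]
    · simp only [pd_mul_x, h, if_neg h3, sub_zero]
      simp only [add_mul, mul_add, mul_assoc, mul_ite, mul_zero, add_assoc]
    · simp only [pd_mul_t, h]
      simp only [add_mul, mul_add, mul_assoc, mul_ite, mul_zero, add_assoc]
    · simp only [pd_mul_v, h, if_neg h3, add_zero]
      simp only [add_mul, mul_assoc]

/-! ### The generators of `U_q` as linear forms -/

variable (a) in
/-- The counit of `F_q`, as a linear form. -/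
abbrev counit : Fq a →ₗ[ℂ] ℂ := Coalgebra.counit

lemma counit_mul (f g : Fq a) : counit a (f * g) = counit a f * counit a g :=
  Bialgebra.counit_mul f g

@[simp] lemma counit_one : counit a 1 = 1 := Bialgebra.counit_one

@[simp] lemma counit_gen (g : Gen) : counit a (gen a g) = 0 := by
  change counitHom a (gen a g) = 0
  rw [counitHom, lift_gen]

lemma counit_bar (i : Fin 4) (f : Fq a) : counit a (bar a i f) = 0 := by
  fin_cases i
  · change counit a (bar a 0 f) = 0
    simp only [bar_mu_eq, map_add, map_smul, counit_mul, counit_gen, mul_zero, smul_zero, add_zero]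
  · change counit a (bar a 1 f) = 0
    simp only [bar_x_eq, map_add, map_smul, counit_mul, counit_gen, mul_zero, smul_zero, add_zero]
  · change counit a (bar a 2 f) = 0
    rw [bar_t_eq, counit_mul, counit_gen, mul_zero]
  · change counit a (bar a 3 f) = 0
    rw [bar_v_eq, counit_mul, counit_gen, mul_zero]

lemma counit_normalOrder (φ : MvPolynomial (Fin 4) ℂ) :
    counit a (normalOrder a φ) = MvPolynomial.constantCoeff φ := by
  induction φ using MvPolynomial.induction_on with
  | C b =>
    rw [← mul_one (MvPolynomial.C b), ← MvPolynomial.smul_eq_C_mul]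
    simp [normalOrder_one]
  | add p q hp hq => simp only [map_add, hp, hq]
  | mul_X p i hp => rw [mul_comm, ← bar_normalOrder, counit_bar]; simp

lemma dualGen_ofConv (i : Fin 4) : (dualGen a i).ofConv = counit a ∘ₗ pd a i := by
  refine LinearMap.ext fun f => ?_
  obtain ⟨φ, rfl⟩ := (normalOrder a).surjective f
  rw [LinearMap.comp_apply, pd_normalOrder, counit_normalOrder, MvPolynomial.constantCoeff_eq,
    MvPolynomial.coeff_pderiv]
  simp [dualGen]

lemma expP_ofConv (c : ℂ) : (expP a c).ofConv = counit a ∘ₗ shift a c := by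
  refine LinearMap.ext fun f => ?_
  obtain ⟨φ, rfl⟩ := (normalOrder a).surjective f
  rw [LinearMap.comp_apply, shift_normalOrder, counit_normalOrder]
  have : (MvPolynomial.aeval ![0, c, 0, 0] : MvPolynomial (Fin 4) ℂ →ₐ[ℂ] ℂ) =
      (MvPolynomial.aeval (0 : Fin 4 → ℂ)).comp (shiftPoly c) := by
    refine MvPolynomial.algHom_ext fun i => ?_
    fin_cases i <;> simp [shiftPoly_X]
  simp [expP, this]

/-- `N = ε ∘ ∂_v` satisfies the product rule dual to `ΔN = N ⊗ e^{-2aP} + 1 ⊗ N`. The operator `∂_v`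
itself obeys no such rule: the counit kills the extra terms. -/
lemma counit_pd_v_mul (f g : Fq a) : (counit a ∘ₗ pd a 3) (f * g) =
    (counit a ∘ₗ pd a 3) f * (counit a ∘ₗ shift a (-2 * a)) g +
      counit a f * (counit a ∘ₗ pd a 3) g := by
  simp only [LinearMap.comp_apply]
  induction g using right_induction with
  | h1 => simp
  | hadd g g' h h' => simp only [mul_add, map_add, h, h']; ring
  | hsmul b g h => simp only [mul_smul_comm, map_smul, h, smul_eq_mul]; ring
  | hgen g i h =>
    rw [← mul_assoc]
    cases i
    · simp [pd_mul_mu, shift_mul_mu]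
    · simp only [pd_mul_x, shift_mul_x, counit_mul, if_true, Fin.reduceEq, if_false, map_sub,
        map_add, map_zero, map_smul, h, smul_eq_mul, counit_gen]
      ring
    · simp [pd_mul_t, shift_mul_t]
    · simp [pd_mul_v, shift_mul_v]

/-! ### Regular actions of linear forms -/

/-- The left action `f₁ ⟨h, f₂⟩` of a linear form `h`. -/
def lact (h : Fq a →ₗ[ℂ] ℂ) : Module.End ℂ (Fq a) :=
  (TensorProduct.rid ℂ (Fq a)).toLinearMap ∘ₗ h.lTensor (Fq a) ∘ₗ Coalgebra.comul

/-- The right action `⟨h, f₁⟩ f₂` of a linear form `h`. -/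
def ract (h : Fq a →ₗ[ℂ] ℂ) : Module.End ℂ (Fq a) :=
  (TensorProduct.lid ℂ (Fq a)).toLinearMap ∘ₗ h.rTensor (Fq a) ∘ₗ Coalgebra.comul

section Twisted

variable {h h₁ h₂ h₃ h₄ : Fq a →ₗ[ℂ] ℂ} (H : ∀ f g, h (f * g) = h₁ f * h₂ g + h₃ f * h₄ g)
include H

/-- A product rule `Δh = h₁ ⊗ h₂ + h₃ ⊗ h₄` for a linear form is inherited by its left action. -/
lemma lact_mul (f g : Fq a) : lact h (f * g) = lact h₁ f * lact h₂ g + lact h₃ f * lact h₄ g := by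
  simp only [lact, LinearMap.comp_apply, Bialgebra.comul_mul]
  generalize (Coalgebra.comul f : Fq a ⊗[ℂ] Fq a) = X
  generalize (Coalgebra.comul g : Fq a ⊗[ℂ] Fq a) = Y
  induction X using TensorProduct.induction_on with
  | zero => simp
  | add p q hp hq => simp only [add_mul, map_add, hp, hq]; abel
  | tmul y z =>
    induction Y using TensorProduct.induction_on with
    | zero => simp
    | add p q hp hq => simp only [mul_add, map_add, hp, hq]; abel
    | tmul y' z' => simp [H, add_smul, smul_smul, mul_comm]

/-- A product rule `Δh = h₁ ⊗ h₂ + h₃ ⊗ h₄` for a linear form is inherited by its right action. -/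
lemma ract_mul (f g : Fq a) : ract h (f * g) = ract h₁ f * ract h₂ g + ract h₃ f * ract h₄ g := by
  simp only [ract, LinearMap.comp_apply, Bialgebra.comul_mul]
  generalize (Coalgebra.comul f : Fq a ⊗[ℂ] Fq a) = X
  generalize (Coalgebra.comul g : Fq a ⊗[ℂ] Fq a) = Y
  induction X using TensorProduct.induction_on with
  | zero => simp
  | add p q hp hq => simp only [add_mul, map_add, hp, hq]; abel
  | tmul y z =>
    induction Y using TensorProduct.induction_on with
    | zero => simp
    | add p q hp hq => simp only [mul_add, map_add, hp, hq]; abel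
    | tmul y' z' => simp [H, add_smul, smul_smul, mul_comm]

end Twisted

lemma lact_zero (f : Fq a) : lact 0 f = 0 := by simp [lact]
lemma ract_zero (f : Fq a) : ract 0 f = 0 := by simp [ract]
lemma lact_counit (f : Fq a) : lact (counit a) f = f := by simp [lact]
lemma ract_counit (f : Fq a) : ract (counit a) f = f := by simp [ract]
lemma lact_one (h : Fq a →ₗ[ℂ] ℂ) : lact h 1 = h 1 • 1 := by
  simp [lact, Algebra.TensorProduct.one_def]
lemma ract_one (h : Fq a →ₗ[ℂ] ℂ) : ract h 1 = h 1 • 1 := by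
  simp [ract, Algebra.TensorProduct.one_def]

lemma comul_gen (g : Gen) : (Coalgebra.comul (gen a g) : Fq a ⊗[ℂ] Fq a) = comulGen a g := by
  change comulHom a (gen a g) = _
  rw [comulHom, lift_gen]

lemma lact_mu (h : Fq a →ₗ[ℂ] ℂ) : lact h (mu a) =
    h 1 • mu a + h (mu a) • 1 + h (x a) • v a + (1 / 2 * h (t a)) • v a ^ 2 := by
  simp [lact, comul_gen, comulGen, smul_smul]

lemma lact_x (h : Fq a →ₗ[ℂ] ℂ) : lact h (x a) = h 1 • x a + h (x a) • 1 + h (t a) • v a := by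
  simp [lact, comul_gen, comulGen]

lemma lact_t (h : Fq a →ₗ[ℂ] ℂ) : lact h (t a) = h 1 • t a + h (t a) • 1 := by
  simp [lact, comul_gen, comulGen]

lemma lact_v (h : Fq a →ₗ[ℂ] ℂ) : lact h (v a) = h 1 • v a + h (v a) • 1 := by
  simp [lact, comul_gen, comulGen]

lemma ract_mu (h : Fq a →ₗ[ℂ] ℂ) : ract h (mu a) =
    h (mu a) • 1 + h 1 • mu a + h (v a) • x a + (1 / 2 * h (v a ^ 2)) • t a := by
  simp [ract, comul_gen, comulGen, smul_smul]

lemma ract_x (h : Fq a →ₗ[ℂ] ℂ) : ract h (x a) = h (x a) • 1 + h 1 • x a + h (v a) • t a := by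
  simp [ract, comul_gen, comulGen]

lemma ract_t (h : Fq a →ₗ[ℂ] ℂ) : ract h (t a) = h (t a) • 1 + h 1 • t a := by
  simp [ract, comul_gen, comulGen]

lemma ract_v (h : Fq a →ₗ[ℂ] ℂ) : ract h (v a) = h (v a) • 1 + h 1 • v a := by
  simp [ract, comul_gen, comulGen]

@[simp] lemma pd_mu_gen (i : Fin 4) : pd a i (mu a) = if i = 0 then 1 else 0 := by
  simpa using pd_mul_mu i (1 : Fq a)
@[simp] lemma pd_x_gen (i : Fin 4) : pd a i (x a) = if i = 1 then 1 else 0 := by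
  simpa using pd_mul_x i (1 : Fq a)
@[simp] lemma pd_t_gen (i : Fin 4) : pd a i (t a) = if i = 2 then 1 else 0 := by
  simpa using pd_mul_t i (1 : Fq a)
@[simp] lemma pd_v_gen (i : Fin 4) : pd a i (v a) = if i = 3 then 1 else 0 := by
  simpa using pd_mul_v i (1 : Fq a)
@[simp] lemma shift_mu_gen (c : ℂ) : shift a c (mu a) = mu a := by
  simpa using shift_mul_mu c (1 : Fq a)
@[simp] lemma shift_x_gen (c : ℂ) : shift a c (x a) = x a + c • 1 := by
  simpa using shift_mul_x c (1 : Fq a)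
@[simp] lemma shift_t_gen (c : ℂ) : shift a c (t a) = t a := by
  simpa using shift_mul_t c (1 : Fq a)
@[simp] lemma shift_v_gen (c : ℂ) : shift a c (v a) = v a := by
  simpa using shift_mul_v c (1 : Fq a)

/-! ### The right regular action -/

/-- `e^{cP}` is multiplicative; the zero second term gives the rule the shape that the lemmas on
product rules ask for. -/
lemma counit_shift_mul (c : ℂ) (f g : Fq a) : (counit a ∘ₗ shift a c) (f * g) =
    (counit a ∘ₗ shift a c) f * (counit a ∘ₗ shift a c) g + (0 : Fq a →ₗ[ℂ] ℂ) f *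
      (0 : Fq a →ₗ[ℂ] ℂ) g := by
  simp [shift_mul]

/-- The product rule dual to `ΔI = I ⊗ 1 + e^{2aP} ⊗ I`. -/
lemma counit_pd_mu_mul (f g : Fq a) : (counit a ∘ₗ pd a 0) (f * g) =
    (counit a ∘ₗ pd a 0) f * counit a g +
      (counit a ∘ₗ shift a (2 * a)) f * (counit a ∘ₗ pd a 0) g := by
  simp [pd_mu_mul]

/-- `P` and `H` are primitive. -/
lemma counit_pd_mul_of_ne {i : Fin 4} (h0 : i ≠ 0) (h3 : i ≠ 3) (f g : Fq a) :
    (counit a ∘ₗ pd a i) (f * g) =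
      (counit a ∘ₗ pd a i) f * counit a g + counit a f * (counit a ∘ₗ pd a i) g := by
  simp [pd_mul_of_ne h0 h3]

lemma ract_shift (c : ℂ) : ract (counit a ∘ₗ shift a c) = shift a c := by
  refine end_ext (by simp [ract_one]) fun f g h => ?_
  rw [ract_mul (counit_shift_mul c), h, ract_zero, zero_mul, add_zero, shift_mul]
  congr 1
  cases g
  · simp [ract_mu, pow_two, shift_mul]
  · simp [ract_x, add_comm]
  · simp [ract_t]
  · simp [ract_v]

lemma ract_pd_mu : ract (counit a ∘ₗ pd a 0) = pd a 0 := by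
  refine end_ext (by simp [ract_one]) fun f g h => ?_
  rw [ract_mul counit_pd_mu_mul, h, pd_mu_mul, ract_counit, ract_shift]
  congr 2
  cases g
  · simp [ract_mu, pow_two, pd_mul_v]
  · simp [ract_x]
  · simp [ract_t]
  · simp [ract_v]

lemma ract_pd_of_ne {i : Fin 4} (h0 : i ≠ 0) (h3 : i ≠ 3) :
    ract (counit a ∘ₗ pd a i) = pd a i := by
  refine end_ext (by simp [ract_one]) fun f g h => ?_
  rw [ract_mul (counit_pd_mul_of_ne h0 h3), h, pd_mul_of_ne h0 h3, ract_counit, ract_counit]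
  congr 2
  cases g
  · simp [ract_mu, pow_two, pd_mul_v, h0, h3]
  · by_cases h1 : i = 1 <;> simp [ract_x, h3, h1]
  · by_cases h2 : i = 2 <;> simp [ract_t, h2]
  · simp [ract_v, h3]

variable (a) in
/-- The operator by which `N` acts from the right. -/
def rightN : Module.End ℂ (Fq a) :=
  pd a 3 + a • (bar a 0 * shiftOp a * pd a 0 ^ 2) +
    bar a 1 * shiftOp a * pd a 0 + (1 / (2 * a)) • (bar a 2 * (1 - shiftOp a))

lemma rightN_apply (f : Fq a) : rightN a f = pd a 3 f +
    a • bar a 0 (shift a (-2 * a) (pd a 0 (pd a 0 f))) + bar a 1 (shift a (-2 * a) (pd a 0 f)) +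
      (1 / (2 * a)) • bar a 2 (f - shift a (-2 * a) f) := by
  simp only [rightN, shiftOp_eq, pow_two]
  rfl

lemma shift_neg_shift (c : ℂ) (f : Fq a) : shift a (-2 * c) (shift a (2 * c) f) = f := by
  rw [shift_shift, neg_mul, neg_add_cancel, shift_zero]

lemma rightN_mul_mu (f : Fq a) : rightN a (f * mu a) = rightN a f * mu a + f * x a := by
  simp only [rightN_apply, bar_mu_eq, bar_x_eq, bar_t_eq, pd_mul_mu, shift_mul_mu, map_add, map_sub,
    pd_shift, shift_neg_shift, if_true, Fin.reduceEq, if_false, sub_zero, add_zero, pd_pd 3 0]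
  simp only [mul_assoc, add_mul, sub_mul, mul_add, mul_sub, smul_mul_assoc, mul_smul_comm, x_mu,
    v_mu, t_mu, v_mu', pow_two, smul_add, smul_sub]
  match_scalars <;> ring

lemma rightN_mul_x (ha : a ≠ 0) (f : Fq a) :
    rightN a (f * x a) = rightN a f * (x a - (2 * a) • 1) + f * t a := by
  simp only [rightN_apply, bar_mu_eq, bar_x_eq, bar_t_eq, pd_mul_x, shift_mul_x, map_add, map_sub,
    map_smul, pd_shift, if_true, Fin.reduceEq, if_false, sub_zero, add_zero, pd_pd 3 0]
  simp only [mul_assoc, add_mul, sub_mul, mul_add, mul_sub, smul_mul_assoc, mul_smul_comm, x_mu,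
    v_x, v_x', t_x, smul_add, smul_sub, mul_one]
  match_scalars <;> field_simp <;> ring

lemma rightN_mul_t (f : Fq a) : rightN a (f * t a) = rightN a f * t a := by
  simp only [rightN_apply, bar_mu_eq, bar_x_eq, bar_t_eq, pd_mul_t, shift_mul_t, map_sub, pd_shift,
    Fin.reduceEq, if_false, add_zero]
  simp only [mul_assoc, add_mul, sub_mul, smul_mul_assoc, t_mu, v_t, v_t', t_x]

lemma rightN_mul_v (f : Fq a) : rightN a (f * v a) = rightN a f * v a + f := by
  simp only [rightN_apply, bar_mu_eq, bar_x_eq, bar_t_eq, pd_mul_v, shift_mul_v, map_sub, pd_shift,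
    Fin.reduceEq, if_false, if_true, add_zero]
  simp only [mul_assoc, add_mul, sub_mul, smul_mul_assoc, v_mu, v_t, v_x, pow_two, mul_sub,
    mul_smul_comm]
  module

lemma ract_pd_v (ha : a ≠ 0) : ract (counit a ∘ₗ pd a 3) = rightN a := by
  have hx1 : (counit a ∘ₗ pd a 3) (v a ^ 2) = 0 := by simp [pow_two, pd_mul_v]
  have hx2 : (counit a ∘ₗ shift a (-2 * a)) (v a ^ 2) = 0 := by
    simp [pow_two, shift_mul_v]
  refine end_ext (by simp [ract_one, rightN_apply]) fun f g h => ?_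
  rw [ract_mul counit_pd_v_mul, h, ract_counit, ract_shift]
  cases g
  · simp [ract_mu, hx1, rightN_mul_mu]
  · simp [ract_x, rightN_mul_x ha, sub_eq_add_neg]
  · simp [ract_t, rightN_mul_t]
  · simp [ract_v, rightN_mul_v]

/-! ### The left regular action -/

lemma lact_pd_v : lact (counit a ∘ₗ pd a 3) = pd a 3 := by
  refine end_ext (by simp [lact_one]) fun f g h => ?_
  rw [lact_mul counit_pd_v_mul, h, lact_counit]
  cases g
  · simp [lact_mu, pd_mul_mu, mul_add, sub_eq_add_neg]
  · simp [lact_x, pd_mul_x, mul_add, sub_eq_add_neg]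
  · simp [lact_t, pd_mul_t]
  · simp [lact_v, pd_mul_v]

/-- The left action of `e^{2aP}` is `e^{2a∂_x} (1 + T)²`. It enters the left action of `I` through
the coproduct of `I`. -/
lemma lact_shift_apply (f : Fq a) : lact (counit a ∘ₗ shift a (2 * a)) f =
    shift a (2 * a) (f + (2 : ℂ) • tOp a f + tOp a (tOp a f)) := by
  have : lact (counit a ∘ₗ shift a (2 * a)) =
      shift a (2 * a) * (1 + (2 : ℂ) • tOp a + tOp a * tOp a) := by
    refine end_ext (by simp [lact_one, tOp_apply]) fun f g h => ?_
    rw [lact_mul (counit_shift_mul (2 * a)), h, lact_zero, zero_mul, add_zero]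
    simp only [Module.End.mul_apply, LinearMap.add_apply, LinearMap.smul_apply,
      Module.End.one_apply]
    cases g
    · simp only [lact_mu, tOp_mul_mu, map_add, map_smul, shift_mul_mu, tOp_mul_v, shift_mul_v,
        LinearMap.comp_apply, shift_mu_gen, shift_x_gen, shift_t_gen, shift_one, counit_gen,
        counit_one, mul_zero, smul_eq_mul, mul_one, zero_smul, zero_add, add_zero, mul_add, add_mul,
        mul_smul_comm, smul_mul_assoc, one_smul]
      module
    · simp only [lact_x, tOp_mul_x, map_add, map_smul, shift_mul_x, LinearMap.comp_apply,
        shift_x_gen, shift_t_gen, shift_one, counit_gen, counit_one, smul_eq_mul, mul_one,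
        zero_smul, zero_add, add_zero, mul_add, add_mul, mul_smul_comm, smul_mul_assoc, one_smul]
      module
    · simp [lact_t, tOp_mul_t, shift_mul_t, add_mul]
    · simp [lact_v, tOp_mul_v, shift_mul_v, add_mul]
  exact LinearMap.congr_fun this f

lemma shift_tOp (c : ℂ) (f : Fq a) : shift a c (tOp a f) = tOp a (shift a c f) := by
  rw [tOp_apply, tOp_apply, map_smul, shift_mul_v, ← pd_shift, shift_shift, shift_shift, add_comm]

lemma shift_tOp_eq (f : Fq a) : shift a (2 * a) (tOp a f) = a • (pd a 0 f * v a) := by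
  rw [shift_tOp, tOp_apply, shift_neg_shift]

lemma lact_pd_mu : lact (counit a ∘ₗ pd a 0) = (1 + tOp a) * pd a 0 := by
  refine end_ext (by simp [lact_one]) fun f g h => ?_
  rw [lact_mul counit_pd_mu_mul, h, lact_counit, lact_shift_apply]
  simp only [Module.End.mul_apply, LinearMap.add_apply, Module.End.one_apply]
  cases g
  · have h1 : lact (counit a ∘ₗ pd a 0) (mu a) = 1 := by simp [lact_mu]
    have h2 : shift a (2 * a) (tOp a (tOp a f)) = a • (tOp a (pd a 0 f) * v a) := by
      rw [shift_tOp, shift_tOp_eq, map_smul, tOp_mul_v]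
    rw [h1, pd_mul_mu]
    simp only [map_add, map_smul, h2, ← shift_tOp (2 * a), shift_tOp_eq, tOp_mul_mu, if_true,
      Fin.reduceEq, if_false, sub_zero, mul_one, add_mul, smul_add]
    module
  · simp [lact_x, pd_mul_x, tOp_mul_x, add_mul]
  · simp [lact_t, pd_mul_t, tOp_mul_t, add_mul]
  · simp [lact_v, pd_mul_v, tOp_mul_v, add_mul]

lemma seriesOp_tOp_mul (c : PowerSeries ℂ) {g : Fq a}
    (h : ∀ f, tOp a (f * g) = tOp a f * g) (f : Fq a) :
    seriesOp c (tOp a) (tOp_locNil a) (f * g) = seriesOp c (tOp a) (tOp_locNil a) f * g :=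
  (LinearMap.congr_fun (seriesOp_commute (S := LinearMap.mulRight ℂ g) (tOp_locNil a) c
    (LinearMap.ext fun f => (h f).symm)).eq f).symm

/-- The recursion `[c(T), R_μ] = a v̄ (1 + T) c'(T)`. The coefficient `(1 + T) c'(T)` is `1` for
`c = log (1 + T)` and `-(1 + T)⁻¹` for `c = (1 + T)⁻¹`. -/
lemma seriesOp_tOp_mul_mu (c : PowerSeries ℂ) (f : Fq a) :
    seriesOp c (tOp a) (tOp_locNil a) (f * mu a) = seriesOp c (tOp a) (tOp_locNil a) f * mu a +
      a • (seriesOp ((1 + PowerSeries.X) * PowerSeries.derivative ℂ c) (tOp a) (tOp_locNil a) f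
        * v a) := by
  have := seriesOp_comm_of_comm c (tOp_locNil a) (R := LinearMap.mulRight ℂ (mu a))
    (B := a • (LinearMap.mulRight ℂ (v a) * (1 + tOp a)))
    (LinearMap.ext fun f => by simp [tOp_mul_mu])
    (LinearMap.ext fun f => by simp [tOp_mul_v])
  rw [seriesOp_mul, seriesOp_add, seriesOp_one, seriesOp_X]
  exact LinearMap.congr_fun this f

lemma one_add_X_mul_derivative_log :
    (1 + PowerSeries.X) * PowerSeries.derivative ℂ (PowerSeries.log ℂ) = 1 := by
  have h : PowerSeries.derivative ℂ (PowerSeries.log ℂ) = _ := PowerSeries.deriv_log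
  rw [h, add_mul, one_mul]
  ext n
  cases n with
  | zero => simp
  | succ n => simp [PowerSeries.coeff_succ_X_mul, PowerSeries.coeff_one, pow_succ]

lemma one_add_X_mul_inv : (1 + PowerSeries.X : PowerSeries ℂ) * (1 + PowerSeries.X)⁻¹ = 1 :=
  PowerSeries.mul_inv_cancel _ (by simp)

lemma one_add_X_mul_derivative_inv :
    (1 + PowerSeries.X) * PowerSeries.derivative ℂ ((1 + PowerSeries.X)⁻¹ : PowerSeries ℂ) =
      -(1 + PowerSeries.X)⁻¹ := by
  have h : PowerSeries.derivative ℂ ((1 + PowerSeries.X)⁻¹ : PowerSeries ℂ) = _ :=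
    PowerSeries.derivative_inv' _
  rw [h]
  simp only [map_add, Derivation.map_one_eq_zero, PowerSeries.derivative_X, zero_add, mul_one]
  linear_combination (-(1 + PowerSeries.X : PowerSeries ℂ)⁻¹) * one_add_X_mul_inv

lemma seriesOp_tOp_one (c : PowerSeries ℂ) :
    seriesOp c (tOp a) (tOp_locNil a) 1 = PowerSeries.constantCoeff c • 1 := by
  have : (tOp a ^ 1) (1 : Fq a) = 0 := by simp [tOp_apply]
  rw [seriesOp_apply_eq_sum _ _ this]
  simp

lemma lact_pd_x (ha : a ≠ 0) : lact (counit a ∘ₗ pd a 1) =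
    pd a 1 + (1 / a) • seriesOp (PowerSeries.log ℂ) (tOp a) (tOp_locNil a) := by
  refine end_ext (by simp [lact_one, seriesOp_tOp_one]) fun f g h => ?_
  rw [lact_mul (counit_pd_mul_of_ne (by decide) (by decide)), h, lact_counit, lact_counit]
  simp only [LinearMap.add_apply, LinearMap.smul_apply]
  cases g
  · have h1 : lact (counit a ∘ₗ pd a 1) (mu a) = v a := by simp [lact_mu]
    rw [h1, seriesOp_tOp_mul_mu, one_add_X_mul_derivative_log, seriesOp_one, pd_mul_mu]
    simp only [Module.End.one_apply, Fin.reduceEq, if_false, add_zero, sub_zero, smul_add,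
      smul_smul, one_div, inv_mul_cancel₀ ha, one_smul, add_mul, smul_mul_assoc]
    abel
  · rw [seriesOp_tOp_mul _ tOp_mul_x, pd_mul_x]
    simp [lact_x, add_mul]
    abel
  · rw [seriesOp_tOp_mul _ tOp_mul_t, pd_mul_t]
    simp [lact_t, add_mul]
  · rw [seriesOp_tOp_mul _ tOp_mul_v, pd_mul_v]
    simp [lact_v, add_mul]

lemma lact_pd_t (ha : a ≠ 0) : lact (counit a ∘ₗ pd a 2) = pd a 2 + (1 / (2 * a)) •
    (bar a 3 * (1 - shiftOp a * seriesOp (1 + PowerSeries.X)⁻¹ (tOp a) (tOp_locNil a))) := by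
  refine end_ext (by simp [lact_one, seriesOp_tOp_one, shiftOp_eq]) fun f g h => ?_
  rw [lact_mul (counit_pd_mul_of_ne (by decide) (by decide)), h, lact_counit, lact_counit]
  simp only [LinearMap.add_apply, LinearMap.smul_apply, Module.End.mul_apply, LinearMap.sub_apply,
    bar_v_eq, shiftOp_eq, Module.End.one_apply]
  cases g
  · have h1 : lact (counit a ∘ₗ pd a 2) (mu a) = (1 / 2 : ℂ) • v a ^ 2 := by simp [lact_mu]
    rw [h1, seriesOp_tOp_mul_mu, one_add_X_mul_derivative_inv, seriesOp_neg, pd_mul_mu]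
    simp only [LinearMap.neg_apply, Fin.reduceEq, if_false, add_zero, sub_zero, map_add, map_smul,
      shift_mul_mu, shift_mul_v, neg_mul, map_neg, add_mul, smul_mul_assoc, mul_smul_comm, sub_mul,
      mul_assoc, v_mu, pow_two, mul_sub]
    match_scalars <;> field_simp
    ring
  · have h1 : lact (counit a ∘ₗ pd a 2) (x a) = v a := by simp [lact_x]
    rw [h1, seriesOp_tOp_mul _ tOp_mul_x, pd_mul_x]
    simp only [Fin.reduceEq, if_false, add_zero, sub_zero, shift_mul_x, add_mul, smul_mul_assoc,
      mul_smul_comm, sub_mul, mul_assoc, v_x, mul_sub]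
    match_scalars <;> field_simp
    ring
  · have h1 : lact (counit a ∘ₗ pd a 2) (t a) = 1 := by simp [lact_t]
    rw [h1, seriesOp_tOp_mul _ tOp_mul_t, pd_mul_t]
    simp only [if_true, shift_mul_t, add_mul, smul_mul_assoc, sub_mul, mul_assoc, v_t, mul_one]
    abel
  · have h1 : lact (counit a ∘ₗ pd a 2) (v a) = 0 := by simp [lact_v]
    rw [h1, seriesOp_tOp_mul _ tOp_mul_v, pd_mul_v]
    simp only [Fin.reduceEq, if_false, shift_mul_v, add_mul, smul_mul_assoc, sub_mul, mul_zero,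
      add_zero]

end Fq
end QGalilei
end

noncomputable section
namespace QGalilei
namespace Uq

variable {a : ℂ}

/-! ### The pairing of `U_q` with `F_q` and the regular actions -/

lemma pair_add (h h' : Uq a) (f : Fq a) : pair (h + h') f = pair h f + pair h' f := rfl
lemma pair_sub (h h' : Uq a) (f : Fq a) : pair (h - h') f = pair h f - pair h' f := rfl
lemma pair_neg (h : Uq a) (f : Fq a) : pair (-h) f = -pair h f := rfl
lemma pair_smul (c : ℂ) (h : Uq a) (f : Fq a) : pair (c • h) f = c * pair h f := rfl
lemma pair_one (f : Fq a) : pair (1 : Uq a) f = counit a f := rfl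

lemma pair_ext {h h' : Uq a} (H : ∀ f, pair h f = pair h' f) : h = h' :=
  Subtype.ext (WithConv.ofConv_injective (LinearMap.ext H))

lemma pair_leftAct (h h' : Uq a) (f : Fq a) : pair h' (leftAct h f) = pair (h' * h) f := by
  change (h' : FullDual a).ofConv (TensorProduct.rid ℂ (Fq a) ((h : FullDual a).ofConv.lTensor
    (Fq a) (Coalgebra.comul f))) = LinearMap.mul' ℂ ℂ (TensorProduct.map (h' : FullDual a).ofConv
      (h : FullDual a).ofConv (Coalgebra.comul f))
  generalize (Coalgebra.comul f : Fq a ⊗[ℂ] Fq a) = X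
  induction X using TensorProduct.induction_on with
  | zero => simp
  | add p q hp hq => simp only [map_add, hp, hq]
  | tmul y z => simp [mul_comm]

lemma pair_rightAct (h h' : Uq a) (f : Fq a) : pair h' (rightAct h f) = pair (h * h') f := by
  change (h' : FullDual a).ofConv (TensorProduct.lid ℂ (Fq a) ((h : FullDual a).ofConv.rTensor
    (Fq a) (Coalgebra.comul f))) = LinearMap.mul' ℂ ℂ (TensorProduct.map (h : FullDual a).ofConv
      (h' : FullDual a).ofConv (Coalgebra.comul f))
  generalize (Coalgebra.comul f : Fq a ⊗[ℂ] Fq a) = X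
  induction X using TensorProduct.induction_on with
  | zero => simp
  | add p q hp hq => simp only [map_add, hp, hq]
  | tmul y z => simp

@[simp] lemma rightAct_I : rightAct (I a) = pd a 0 := by
  change ract (dualGen a 0).ofConv = _
  rw [dualGen_ofConv, ract_pd_mu]

@[simp] lemma rightAct_P : rightAct (P a) = pd a 1 := by
  change ract (dualGen a 1).ofConv = _
  rw [dualGen_ofConv, ract_pd_of_ne (by decide) (by decide)]

@[simp] lemma rightAct_H : rightAct (H a) = pd a 2 := by
  change ract (dualGen a 2).ofConv = _
  rw [dualGen_ofConv, ract_pd_of_ne (by decide) (by decide)]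

lemma rightAct_N (ha : a ≠ 0) : rightAct (N a) = rightN a := by
  change ract (dualGen a 3).ofConv = _
  rw [dualGen_ofConv, ract_pd_v ha]

@[simp] lemma rightAct_E : rightAct (E a) = shift a a := by
  change ract (expP a a).ofConv = _
  rw [expP_ofConv, ract_shift]

@[simp] lemma rightAct_E' : rightAct (E' a) = shift a (-a) := by
  change ract (expP a (-a)).ofConv = _
  rw [expP_ofConv, ract_shift]

lemma leftAct_I : leftAct (I a) = (1 + tOp a) * pd a 0 := by
  change lact (dualGen a 0).ofConv = _
  rw [dualGen_ofConv, lact_pd_mu]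

lemma leftAct_P (ha : a ≠ 0) : leftAct (P a) =
    pd a 1 + (1 / a) • seriesOp (PowerSeries.log ℂ) (tOp a) (tOp_locNil a) := by
  change lact (dualGen a 1).ofConv = _
  rw [dualGen_ofConv, lact_pd_x ha]

lemma leftAct_H (ha : a ≠ 0) : leftAct (H a) = pd a 2 + (1 / (2 * a)) •
    (bar a 3 * (1 - shiftOp a * seriesOp (1 + PowerSeries.X)⁻¹ (tOp a) (tOp_locNil a))) := by
  change lact (dualGen a 2).ofConv = _
  rw [dualGen_ofConv, lact_pd_t ha]

lemma leftAct_N : leftAct (N a) = pd a 3 := by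
  change lact (dualGen a 3).ofConv = _
  rw [dualGen_ofConv, lact_pd_v]

/-- Together with `pair_mul` this evaluates a product in `U_q` by applying the right actions of its
factors one after the other, so that the relations of `U_q` become identities of differential
operators, composed in the opposite order and followed by the counit. -/
lemma pair_eq_counit_rightAct (h : Uq a) (f : Fq a) : pair h f = counit a (rightAct h f) := by
  rw [← pair_one, pair_rightAct, mul_one]

lemma pair_mul (h h' : Uq a) (f : Fq a) : pair (h * h') f = pair h' (rightAct h f) :=
  (pair_rightAct h h' f).symm

lemma I_mul_P : I a * P a = P a * I a := pair_ext fun f => by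
  simp [pair_mul, pair_eq_counit_rightAct (P a), pair_eq_counit_rightAct (I a), pd_pd 0 1]

lemma I_mul_H : I a * H a = H a * I a := pair_ext fun f => by
  simp [pair_mul, pair_eq_counit_rightAct (H a), pair_eq_counit_rightAct (I a), pd_pd 0 2]

lemma P_mul_H : P a * H a = H a * P a := pair_ext fun f => by
  simp [pair_mul, pair_eq_counit_rightAct (H a), pair_eq_counit_rightAct (P a), pd_pd 1 2]

lemma E_mul_E' : E a * E' a = 1 := pair_ext fun f => by
  simp [pair_mul, pair_eq_counit_rightAct (E' a), shift_shift, pair_one]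

lemma shift_neg_two (f : Fq a) : shift a (-2 * a) f = shift a (-a) (shift a (-a) f) := by
  rw [shift_shift]; congr 2; ring

/-! ### Commutation relations of `N` with the generators of the Abelian subalgebra -/

/-- Like the next four relations, this one is kept in additive form, which moves `N` to the right
past an element of `K`. -/
lemma N_mul_I (ha : a ≠ 0) : N a * I a = I a * N a + a • (E' a ^ 2 * I a ^ 2) :=
  pair_ext fun f => by
  simp only [pair_add, pair_smul, pow_succ, pow_zero, one_mul, mul_assoc, pair_mul,
    pair_eq_counit_rightAct (N a), pair_eq_counit_rightAct (I a), rightAct_I, rightAct_E',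
    rightAct_N ha, rightN_apply, map_add, map_sub, map_smul, pd_bar_self, pd_bar_of_ne, ne_eq,
    Fin.reduceEq, not_false_eq_true, counit_bar, pd_shift, pd_pd 3, shift_neg_two, smul_eq_mul]
  ring

lemma N_mul_P (ha : a ≠ 0) : N a * P a = P a * N a + E' a ^ 2 * I a :=
  pair_ext fun f => by
  simp only [pair_add, pow_succ, pow_zero, one_mul, mul_assoc, pair_mul,
    pair_eq_counit_rightAct (N a), pair_eq_counit_rightAct (I a), pair_eq_counit_rightAct (P a),
    rightAct_I, rightAct_P, rightAct_E', rightAct_N ha, rightN_apply, map_add, map_sub, map_smul,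
    pd_bar_self, pd_bar_of_ne, ne_eq, Fin.reduceEq, not_false_eq_true, counit_bar, pd_shift,
    pd_pd 3, shift_neg_two, smul_eq_mul]
  ring

lemma N_mul_H (ha : a ≠ 0) : N a * H a = H a * N a + (1 / (2 * a)) • (1 + (-1 : ℂ) • E' a ^ 2) :=
  pair_ext fun f => by
  simp only [pair_add, pair_smul, pow_succ, pow_zero, one_mul, pair_mul,
    pair_eq_counit_rightAct (N a), pair_eq_counit_rightAct (H a), pair_eq_counit_rightAct (E' a),
    rightAct_H, rightAct_E', rightAct_N ha, rightN_apply, pair_one, map_add, map_sub, map_smul,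
    pd_bar_self, pd_bar_of_ne, ne_eq, Fin.reduceEq, not_false_eq_true, counit_bar, pd_shift,
    pd_pd 3, shift_neg_two, smul_eq_mul]
  ring

lemma N_mul_E (ha : a ≠ 0) : N a * E a = E a * N a + a • (E' a * I a) :=
  pair_ext fun f => by
  have h : ∀ g : Fq a, shift a a (shift a (-a) g) = g := fun g => by simp [shift_shift]
  simp only [pair_add, pair_smul, pair_mul, pair_eq_counit_rightAct (N a),
    pair_eq_counit_rightAct (I a), pair_eq_counit_rightAct (E a), rightAct_I, rightAct_E,
    rightAct_E', rightAct_N ha, rightN_apply, map_add, map_sub, map_smul, shift_bar_x,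
    shift_bar_of_ne, ne_eq, Fin.reduceEq, not_false_eq_true, counit_bar, pd_shift, shift_neg_two,
    smul_eq_mul, h]
  ring

lemma N_mul_E' (ha : a ≠ 0) : N a * E' a = E' a * N a + (-a) • (E' a ^ 3 * I a) :=
  pair_ext fun f => by
  simp only [pair_add, pair_smul, pow_succ, pow_zero, one_mul, mul_assoc, pair_mul,
    pair_eq_counit_rightAct (N a), pair_eq_counit_rightAct (I a), pair_eq_counit_rightAct (E' a),
    rightAct_I, rightAct_E', rightAct_N ha, rightN_apply, map_add, map_sub, map_smul, shift_bar_x,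
    shift_bar_of_ne, ne_eq, Fin.reduceEq, not_false_eq_true, counit_bar, pd_shift, shift_neg_two,
    smul_eq_mul]
  ring

lemma I_comm_N (ha : a ≠ 0) : I a * N a - N a * I a = -(a • (E' a ^ 2 * I a ^ 2)) :=
  pair_ext fun f => by
  rw [N_mul_I ha, pair_sub, pair_neg, pair_add, sub_add_cancel_left]

lemma P_comm_N (ha : a ≠ 0) : P a * N a - N a * P a = -(E' a ^ 2 * I a) :=
  pair_ext fun f => by
  rw [N_mul_P ha, pair_sub, pair_neg, pair_add, sub_add_cancel_left]

lemma H_comm_N (ha : a ≠ 0) : H a * N a - N a * H a = -((1 / (2 * a)) • (1 - E' a ^ 2)) :=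
  pair_ext fun f => by
  simp only [N_mul_H ha, pair_sub, pair_neg, pair_add, pair_smul]
  ring

/-! ### Duality of the bases -/

/-- In contrast to `pair_mul`, the rightmost factor acts first. -/
lemma pair_mul' (h h' : Uq a) (f : Fq a) : pair (h * h') f = pair h (leftAct h' f) :=
  (pair_leftAct h' h f).symm

lemma pair_pow_mul (h h' : Uq a) (n : ℕ) (f : Fq a) :
    pair (h ^ n * h') f = pair h' ((rightAct h ^ n) f) := by
  induction n generalizing f with
  | zero => simp
  | succ n ih => rw [pow_succ', mul_assoc, pair_mul, ih, pow_succ, Module.End.mul_apply]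

lemma pair_N_pow (n : ℕ) (f : Fq a) : pair (N a ^ n) f = counit a ((pd a 3 ^ n) f) := by
  induction n generalizing f with
  | zero => simp [pair_one]
  | succ n ih => rw [pow_succ, pair_mul', leftAct_N, ih, pow_succ, Module.End.mul_apply]

/-- `I`, `P` and `H` are moved off from the left, by right actions, and `N` from the right, by left
actions, as these are the actions by plain partial derivatives. -/
lemma pair_basis (p q r s : ℕ) (f : Fq a) : pair (I a ^ p * P a ^ q * H a ^ r * N a ^ s) f =
    counit a ((pd a 3 ^ s) ((pd a 2 ^ r) ((pd a 1 ^ q) ((pd a 0 ^ p) f)))) := by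
  rw [mul_assoc, mul_assoc, pair_pow_mul, pair_pow_mul, pair_pow_mul, pair_N_pow, rightAct_I,
    rightAct_P, rightAct_H]

lemma ordMon_eq (m : Fin 4 →₀ ℕ) : ordMon a m = normalOrder a (MvPolynomial.monomial m 1) := by
  rw [normalOrder_monomial, one_smul]

lemma pd_ordMon (i : Fin 4) (m : Fin 4 →₀ ℕ) :
    pd a i (ordMon a m) = (m i : ℂ) • ordMon a (m - Finsupp.single i 1) := by
  rw [ordMon_eq, pd_normalOrder, MvPolynomial.pderiv_monomial, normalOrder_monomial, one_mul]

lemma pd_pow_ordMon (i : Fin 4) (n : ℕ) (m : Fin 4 →₀ ℕ) : (pd a i ^ n) (ordMon a m) =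
    ((m i).descFactorial n : ℂ) • ordMon a (m - Finsupp.single i n) := by
  induction n with
  | zero => simp
  | succ n ih =>
    rw [pow_succ', Module.End.mul_apply, ih, map_smul, pd_ordMon, smul_smul, tsub_tsub,
      ← Finsupp.single_add, Nat.descFactorial_succ]
    congr 1
    simp [mul_comm]

lemma counit_ordMon (m : Fin 4 →₀ ℕ) : counit a (ordMon a m) = if m = 0 then 1 else 0 := by
  rw [ordMon_eq, counit_normalOrder, MvPolynomial.constantCoeff_monomial]

lemma pair_basis_ordMon (p q r s : ℕ) (m : Fin 4 →₀ ℕ) :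
    pair (I a ^ p * P a ^ q * H a ^ r * N a ^ s) (ordMon a m) =
      if p = m 0 ∧ q = m 1 ∧ r = m 2 ∧ s = m 3 then
        ((p.factorial * q.factorial * r.factorial * s.factorial : ℕ) : ℂ) else 0 := by
  rw [pair_basis]
  simp only [pd_pow_ordMon, map_smul, counit_ordMon, smul_eq_mul, tsub_tsub]
  have h0 : m - (Finsupp.single 0 p + (Finsupp.single 1 q + (Finsupp.single 2 r
      + Finsupp.single 3 s))) = 0 ↔ m 0 ≤ p ∧ m 1 ≤ q ∧ m 2 ≤ r ∧ m 3 ≤ s := by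
    simp [Finsupp.ext_iff, Fin.forall_fin_succ, Nat.sub_eq_zero_iff_le]
  simp only [← add_assoc] at h0 ⊢
  rw [if_congr h0 rfl rfl]
  simp only [Finsupp.tsub_apply, Finsupp.add_apply, Finsupp.single_apply, Fin.reduceEq, if_false,
    add_zero, tsub_zero]
  split_ifs with h1 h2 h2
  · obtain ⟨rfl, rfl, rfl, rfl⟩ := h2
    simp only [Nat.descFactorial_self]
    push_cast
    ring
  · have : m 0 < p ∨ m 1 < q ∨ m 2 < r ∨ m 3 < s := by omega
    rcases this with h | h | h | h <;> simp [Nat.descFactorial_of_lt h]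
  · exact absurd ⟨h2.1.ge, h2.2.1.ge, h2.2.2.1.ge, h2.2.2.2.ge⟩ h1
  · simp

/-- On `F_q` the exponential series of `cP` sums to the shift of `x` by `c`; the sum is finite. -/
lemma hasSum_exp_mul_pair_P_pow (c : ℂ) (h : Uq a) (f : Fq a) :
    HasSum (fun n : ℕ => c ^ n / n.factorial * pair (P a ^ n * h) f) (pair h (shift a c f)) := by
  have : HasSum _ (pair h (shift a c f)) :=
    hasSum_seriesOp (h : FullDual a).ofConv (PowerSeries.exp ℂ) ((pd_locNil a 1).smul c) f
  convert this using 1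
  funext n
  rw [pair_pow_mul, rightAct_P, smul_pow, LinearMap.smul_apply, map_smul, PowerSeries.coeff_exp]
  simp only [smul_eq_mul, map_div₀, map_one, map_natCast]
  change c ^ n / n.factorial * (h : FullDual a).ofConv _ = _
  ring

/-! ### The decomposition of `U_q` over its Abelian subalgebra -/

lemma I_mem_K : I a ∈ K a := (kI a).2
lemma P_mem_K : P a ∈ K a := (kP a).2
lemma H_mem_K : H a ∈ K a := (kH a).2
lemma E_mem_K : E a ∈ K a := (kE a).2
lemma E'_mem_K : E' a ∈ K a := (kE' a).2

/-- The commutator with `N` maps `K` to itself. -/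
lemma exists_N_mul (ha : a ≠ 0) {k : Uq a} (hk : k ∈ K a) : ∃ k' ∈ K a, N a * k = k * N a + k' := by
  induction hk using Algebra.adjoin_induction with
  | mem k hk =>
    simp only [Set.mem_insert_iff, Set.mem_singleton_iff] at hk
    rcases hk with rfl | rfl | rfl | rfl | rfl
    · exact ⟨_, Subalgebra.smul_mem _ (mul_mem (pow_mem E'_mem_K 2) (pow_mem I_mem_K 2)) _,
        N_mul_I ha⟩
    · exact ⟨_, mul_mem (pow_mem E'_mem_K 2) I_mem_K, N_mul_P ha⟩
    · exact ⟨_, Subalgebra.smul_mem _ (add_mem (one_mem _)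
        (Subalgebra.smul_mem _ (pow_mem E'_mem_K 2) _)) _, N_mul_H ha⟩
    · exact ⟨_, Subalgebra.smul_mem _ (mul_mem E'_mem_K I_mem_K) _, N_mul_E ha⟩
    · exact ⟨_, Subalgebra.smul_mem _ (mul_mem (pow_mem E'_mem_K 3) I_mem_K) _, N_mul_E' ha⟩
  | algebraMap r => exact ⟨0, zero_mem _, by rw [Algebra.commutes, add_zero]⟩
  | add k k' _ _ h h' =>
    obtain ⟨l, hl, e⟩ := h
    obtain ⟨l', hl', e'⟩ := h'
    exact ⟨l + l', add_mem hl hl', by rw [mul_add, e, e', add_mul]; abel⟩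
  | mul k k' hk hk' h h' =>
    obtain ⟨l, hl, e⟩ := h
    obtain ⟨l', hl', e'⟩ := h'
    exact ⟨k * l' + l * k', add_mem (mul_mem hk hl') (mul_mem hl hk'), by
      rw [← mul_assoc, e, add_mul, mul_assoc, e', mul_add, ← mul_assoc, add_assoc]⟩

variable (a) in
/-- The span of the products `k N ^ s` with `k` in the Abelian subalgebra. -/
def spanKN : Submodule ℂ (Uq a) := Submodule.span ℂ {h | ∃ k ∈ K a, ∃ s : ℕ, k * N a ^ s = h}

lemma mul_mem_spanKN {k w : Uq a} (hk : k ∈ K a) (hw : w ∈ spanKN a) : k * w ∈ spanKN a := by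
  induction hw using Submodule.span_induction with
  | mem w hw =>
    obtain ⟨k', hk', s, rfl⟩ := hw
    exact Submodule.subset_span ⟨k * k', mul_mem hk hk', s, mul_assoc _ _ _⟩
  | zero => rw [mul_zero]; exact zero_mem _
  | add w w' _ _ h h' => rw [mul_add]; exact add_mem h h'
  | smul c w _ h => rw [mul_smul_comm]; exact Submodule.smul_mem _ _ h

lemma N_mul_mem_spanKN (ha : a ≠ 0) {w : Uq a} (hw : w ∈ spanKN a) : N a * w ∈ spanKN a := by
  induction hw using Submodule.span_induction with
  | mem w hw =>
    obtain ⟨k, hk, s, rfl⟩ := hw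
    obtain ⟨k', hk', e⟩ := exists_N_mul ha hk
    rw [← mul_assoc, e, add_mul, mul_assoc, ← pow_succ']
    exact add_mem (Submodule.subset_span ⟨k, hk, s + 1, rfl⟩)
      (Submodule.subset_span ⟨k', hk', s, rfl⟩)
  | zero => rw [mul_zero]; exact zero_mem _
  | add w w' _ _ h h' => rw [mul_add]; exact add_mem h h'
  | smul c w _ h => rw [mul_smul_comm]; exact Submodule.smul_mem _ _ h

/-- `U_q` is generated by the powers of `N` as a left `K`-module. -/
lemma mem_spanKN (ha : a ≠ 0) (h : Uq a) : h ∈ spanKN a := by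
  suffices H : ∀ (x : FullDual a) (hx : x ∈ Uq a), ∀ w ∈ spanKN a,
      (⟨x, hx⟩ : Uq a) * w ∈ spanKN a by
    have := H h h.2 1 (Submodule.subset_span ⟨1, one_mem _, 0, by simp⟩)
    rwa [mul_one] at this
  intro x hx
  induction hx using Algebra.adjoin_induction with
  | mem x hx =>
    intro w hw
    simp only [Set.mem_insert_iff, Set.mem_singleton_iff] at hx
    rcases hx with rfl | rfl | rfl | rfl | rfl | rfl
    · exact mul_mem_spanKN I_mem_K hw
    · exact mul_mem_spanKN P_mem_K hw
    · exact mul_mem_spanKN H_mem_K hw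
    · exact N_mul_mem_spanKN ha hw
    · exact mul_mem_spanKN E_mem_K hw
    · exact mul_mem_spanKN E'_mem_K hw
  | algebraMap r =>
    intro w hw
    exact mul_mem_spanKN (algebraMap_mem (K a) r) hw
  | add x y hx hy h h' =>
    intro w hw
    have : (⟨x + y, add_mem hx hy⟩ : Uq a) * w = (⟨x, hx⟩ : Uq a) * w + (⟨y, hy⟩ : Uq a) * w :=
      add_mul (⟨x, hx⟩ : Uq a) ⟨y, hy⟩ w
    rw [this]
    exact add_mem (h w hw) (h' w hw)
  | mul x y hx hy h h' =>
    intro w hw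
    have : (⟨x * y, mul_mem hx hy⟩ : Uq a) * w = (⟨x, hx⟩ : Uq a) * ((⟨y, hy⟩ : Uq a) * w) :=
      mul_assoc (⟨x, hx⟩ : Uq a) ⟨y, hy⟩ w
    rw [this]
    exact h _ (h' w hw)

/-! ### Pairing with formal series -/

lemma pairTerm_add (h h' : Uq a) (f : MvPowerSeries (Fin 4) ℂ) :
    pairTerm (h + h') f = pairTerm h f + pairTerm h' f := by
  funext m; simp [pairTerm, pair_add, mul_add]

lemma pairTerm_smul (c : ℂ) (h : Uq a) (f : MvPowerSeries (Fin 4) ℂ) :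
    pairTerm (c • h) f = c • pairTerm h f := by
  funext m; simp [pairTerm, pair_smul]; ring

/-- The element `I^p P^q H^r N^s` reads off a single coefficient of a formal series. -/
lemma hasSum_pairTerm_basis (p q r s : ℕ) (f : MvPowerSeries (Fin 4) ℂ) {m : Fin 4 →₀ ℕ}
    (h0 : m 0 = p) (h1 : m 1 = q) (h2 : m 2 = r) (h3 : m 3 = s) :
    HasSum (pairTerm (I a ^ p * P a ^ q * H a ^ r * N a ^ s) f)
      (MvPowerSeries.coeff m f *
        ((p.factorial * q.factorial * r.factorial * s.factorial : ℕ) : ℂ)) := by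
  convert hasSum_single m ?_ using 1
  · rw [pairTerm, pair_basis_ordMon, if_pos ⟨h0.symm, h1.symm, h2.symm, h3.symm⟩]
  · intro m' hm'
    rw [pairTerm, pair_basis_ordMon, if_neg, mul_zero]
    rintro ⟨e0, e1, e2, e3⟩
    apply hm'
    ext i
    fin_cases i
    · exact e0.symm.trans h0.symm
    · exact e1.symm.trans h1.symm
    · exact e2.symm.trans h2.symm
    · exact e3.symm.trans h3.symm

/-- If `w` arises from `u` by raising one exponent and scaling by `c`, its sum is `c` times that
of `u`. -/
lemma hasSum_of_add_single {i : Fin 4} {R : Type*} [NormedField R] {u w : (Fin 4 →₀ ℕ) → R}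
    {c S : R} (h1 : ∀ m, w (m + Finsupp.single i 1) = c * u m) (h0 : ∀ m, m i = 0 → w m = 0)
    (hu : HasSum u S) : HasSum w (c * S) := by
  have hinj : Function.Injective fun m : Fin 4 →₀ ℕ => m + Finsupp.single i 1 :=
    add_left_injective _
  refine (hinj.hasSum_iff fun m hm => ?_).1 ?_
  · refine h0 m (by_contra fun h => hm ⟨m - Finsupp.single i 1, ?_⟩)
    exact tsub_add_cancel_of_le (by simpa [Nat.one_le_iff_ne_zero] using h)
  · simpa [Function.comp_def, h1] using hu.mul_left c

section Reindex

variable {i : Fin 4} {g : Uq a} (hg : rightAct g = pd a i) {f : MvPowerSeries (Fin 4) ℂ} {c : ℂ}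
  (hf : ∀ m, MvPowerSeries.coeff (m + Finsupp.single i 1) f * (m i + 1) =
    c * MvPowerSeries.coeff m f)
include hg hf

lemma pairTerm_mul_add_single (h : Uq a) (m : Fin 4 →₀ ℕ) :
    pairTerm (g * h) f (m + Finsupp.single i 1) = c * pairTerm h f m := by
  rw [pairTerm, pairTerm, pair_mul, hg, pd_ordMon, add_tsub_cancel_right,
    ← mul_assoc, ← hf]
  change _ * (h : FullDual a).ofConv _ = _ * (h : FullDual a).ofConv _
  rw [map_smul]
  simp
  ring

omit hf in
lemma pairTerm_mul_of_eq_zero (h : Uq a) {m : Fin 4 →₀ ℕ} (hm : m i = 0) :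
    pairTerm (g * h) f m = 0 := by
  rw [pairTerm, pair_mul, hg, pd_ordMon, hm]
  change _ * (h : FullDual a).ofConv _ = _
  simp

/-- An element acting from the right by `∂_i` multiplies by `c` the pairings with an eigenvector `f`
of the `i`-th partial derivative of formal series. -/
lemma hasSum_pairTerm_mul {h : Uq a} {S : ℂ} (hS : HasSum (pairTerm h f) S) :
    HasSum (pairTerm (g * h) f) (c * S) :=
  hasSum_of_add_single (pairTerm_mul_add_single hg hf h)
    (fun _ hm => pairTerm_mul_of_eq_zero hg h hm) hS

lemma hasSum_norm_pairTerm_mul {h : Uq a} {S : ℝ} (hS : HasSum (fun m => ‖pairTerm h f m‖) S) :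
    HasSum (fun m => ‖pairTerm (g * h) f m‖) (‖c‖ * S) :=
  hasSum_of_add_single (fun m => by rw [pairTerm_mul_add_single hg hf h, norm_mul])
    (fun _ hm => by rw [pairTerm_mul_of_eq_zero hg h hm, norm_zero]) hS

end Reindex

/-! ### Pairing with the series `e^{αμ} e^{βx} e^{γt} φ(v)` -/

section Exponential

variable {α β γ : ℂ} {φ : PowerSeries ℂ}

lemma coeff_expSeries (m : Fin 4 →₀ ℕ) : MvPowerSeries.coeff m (expSeries α β γ φ) =
    α ^ m 0 / (m 0).factorial * (β ^ m 1 / (m 1).factorial) * (γ ^ m 2 / (m 2).factorial) *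
      PowerSeries.coeff (m 3) φ := rfl

lemma pow_succ_div_factorial_succ (c : ℂ) (n : ℕ) :
    c ^ (n + 1) / (n + 1).factorial * ((n : ℂ) + 1) = c * (c ^ n / n.factorial) := by
  have h1 : ((n.factorial : ℕ) : ℂ) ≠ 0 := by exact_mod_cast n.factorial_ne_zero
  have h2 : (n : ℂ) + 1 ≠ 0 := by exact_mod_cast n.succ_ne_zero
  rw [Nat.factorial_succ]
  push_cast
  field_simp
  ring

lemma coeff_expSeries_mu (m : Fin 4 →₀ ℕ) :
    MvPowerSeries.coeff (m + Finsupp.single 0 1) (expSeries α β γ φ) * (m 0 + 1) =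
      α * MvPowerSeries.coeff m (expSeries α β γ φ) := by
  have := pow_succ_div_factorial_succ α (m 0)
  simp only [coeff_expSeries, Finsupp.add_apply, Finsupp.single_apply, Fin.reduceEq, if_true,
    if_false, add_zero]
  linear_combination (β ^ m 1 / (m 1).factorial) * (γ ^ m 2 / (m 2).factorial) *
    PowerSeries.coeff (m 3) φ * this

lemma coeff_expSeries_x (m : Fin 4 →₀ ℕ) :
    MvPowerSeries.coeff (m + Finsupp.single 1 1) (expSeries α β γ φ) * (m 1 + 1) =
      β * MvPowerSeries.coeff m (expSeries α β γ φ) := by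
  have := pow_succ_div_factorial_succ β (m 1)
  simp only [coeff_expSeries, Finsupp.add_apply, Finsupp.single_apply, Fin.reduceEq, if_true,
    if_false, add_zero]
  linear_combination (α ^ m 0 / (m 0).factorial) * (γ ^ m 2 / (m 2).factorial) *
    PowerSeries.coeff (m 3) φ * this

lemma coeff_expSeries_t (m : Fin 4 →₀ ℕ) :
    MvPowerSeries.coeff (m + Finsupp.single 2 1) (expSeries α β γ φ) * (m 2 + 1) =
      γ * MvPowerSeries.coeff m (expSeries α β γ φ) := by
  have := pow_succ_div_factorial_succ γ (m 2)
  simp only [coeff_expSeries, Finsupp.add_apply, Finsupp.single_apply, Fin.reduceEq, if_true,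
    if_false, add_zero]
  linear_combination (α ^ m 0 / (m 0).factorial) * (β ^ m 1 / (m 1).factorial) *
    PowerSeries.coeff (m 3) φ * this

lemma hasSum_pairTerm_I_mul {h : Uq a} {S : ℂ} (hS : HasSum (pairTerm h (expSeries α β γ φ)) S) :
    HasSum (pairTerm (I a * h) (expSeries α β γ φ)) (α * S) :=
  hasSum_pairTerm_mul rightAct_I coeff_expSeries_mu hS

lemma hasSum_pairTerm_P_mul {h : Uq a} {S : ℂ} (hS : HasSum (pairTerm h (expSeries α β γ φ)) S) :
    HasSum (pairTerm (P a * h) (expSeries α β γ φ)) (β * S) :=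
  hasSum_pairTerm_mul rightAct_P coeff_expSeries_x hS

lemma hasSum_pairTerm_H_mul {h : Uq a} {S : ℂ} (hS : HasSum (pairTerm h (expSeries α β γ φ)) S) :
    HasSum (pairTerm (H a * h) (expSeries α β γ φ)) (γ * S) :=
  hasSum_pairTerm_mul rightAct_H coeff_expSeries_t hS

lemma hasSum_pairTerm_P_pow_mul {h : Uq a} {S : ℂ}
    (hS : HasSum (pairTerm h (expSeries α β γ φ)) S) (n : ℕ) :
    HasSum (pairTerm (P a ^ n * h) (expSeries α β γ φ)) (β ^ n * S) := by
  induction n with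
  | zero => simpa using hS
  | succ n ih =>
    rw [pow_succ', pow_succ', mul_assoc, mul_assoc]
    exact hasSum_pairTerm_P_mul ih

lemma hasSum_norm_pairTerm_P_pow_mul {h : Uq a} {S : ℝ}
    (hS : HasSum (fun m => ‖pairTerm h (expSeries α β γ φ) m‖) S) (n : ℕ) :
    HasSum (fun m => ‖pairTerm (P a ^ n * h) (expSeries α β γ φ) m‖) (‖β‖ ^ n * S) := by
  induction n with
  | zero => simpa using hS
  | succ n ih =>
    rw [pow_succ', pow_succ', mul_assoc, mul_assoc]
    exact hasSum_norm_pairTerm_mul rightAct_P coeff_expSeries_x ih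

/-- An element acting on `F_q` from the right as `e^{c ∂/∂x}` multiplies the pairings by
`e^{cβ}`: the double series over the exponential and the monomials converges absolutely, and is
summed in both orders. -/
lemma hasSum_pairTerm_exp_mul {g : Uq a} {c : ℂ} (hg : rightAct g = shift a c) {h : Uq a} {S : ℂ}
    (hS : HasSum (pairTerm h (expSeries α β γ φ)) S) :
    HasSum (pairTerm (g * h) (expSeries α β γ φ)) (Complex.exp (c * β) * S) := by
  set F : ℕ × (Fin 4 →₀ ℕ) → ℂ := fun x =>
    c ^ x.1 / x.1.factorial * pairTerm (P a ^ x.1 * h) (expSeries α β γ φ) x.2 with hF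
  have hrow : ∀ n, HasSum (fun m => F (n, m)) ((c * β) ^ n / n.factorial * S) := by
    intro n
    convert! (hasSum_pairTerm_P_pow_mul hS n).mul_left (c ^ n / n.factorial) using 1
    rw [mul_pow]; ring
  have hcol : ∀ m, HasSum (fun n => F (n, m)) (pairTerm (g * h) (expSeries α β γ φ) m) := by
    intro m
    rw [pairTerm, pair_mul, hg]
    convert! (hasSum_exp_mul_pair_P_pow c h (ordMon a m)).mul_left
      (MvPowerSeries.coeff m (expSeries α β γ φ)) using 1
    funext n
    simp only [hF, pairTerm]
    ring
  have hF' : Summable F := by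
    obtain ⟨S', hS'⟩ := hS.summable.norm
    have hrow' : ∀ n, HasSum (fun m => ‖F (n, m)‖) ((‖c‖ * ‖β‖) ^ n / n.factorial * S') := by
      intro n
      convert! (hasSum_norm_pairTerm_P_pow_mul hS' n).mul_left (‖c‖ ^ n / n.factorial) using 1
      · funext m
        simp [hF]
      · rw [mul_pow]; ring
    refine Summable.of_norm ((summable_prod_of_nonneg fun _ => norm_nonneg _).2
      ⟨fun n => (hrow' n).summable, ?_⟩)
    simp only [(hrow' _).tsum_eq]
    exact (Real.summable_pow_div_factorial _).mul_right _
  have hexp : HasSum (fun n : ℕ => (c * β) ^ n / n.factorial * S) (Complex.exp (c * β) * S) := by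
    rw [Complex.exp_eq_exp_ℂ]
    exact (NormedSpace.expSeries_div_hasSum_exp (c * β)).mul_right S
  have h1 := (hF'.hasSum.prod_fiberwise hrow).unique hexp
  have h2 := ((Equiv.prodComm _ _).hasSum_iff.2 hF'.hasSum : HasSum (F ∘ Equiv.prodComm _ _) _)
  rw [← h1]
  exact h2.prod_fiberwise hcol

lemma hasSum_pairTerm_E_mul {h : Uq a} {S : ℂ} (hS : HasSum (pairTerm h (expSeries α β γ φ)) S) :
    HasSum (pairTerm (E a * h) (expSeries α β γ φ)) (Complex.exp (a * β) * S) :=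
  hasSum_pairTerm_exp_mul rightAct_E hS

lemma hasSum_pairTerm_E'_mul {h : Uq a} {S : ℂ} (hS : HasSum (pairTerm h (expSeries α β γ φ)) S) :
    HasSum (pairTerm (E' a * h) (expSeries α β γ φ)) (Complex.exp (-(a * β)) * S) := by
  have := hasSum_pairTerm_exp_mul rightAct_E' hS
  rwa [neg_mul] at this

lemma hasSum_pairTerm_N_pow (s : ℕ) :
    HasSum (pairTerm (N a ^ s) (expSeries α β γ φ)) (s.factorial * PowerSeries.coeff s φ) := by
  have := hasSum_pairTerm_basis (a := a) 0 0 0 s (expSeries α β γ φ) (m := Finsupp.single 3 s)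
    (by simp) (by simp) (by simp) (by simp)
  simp only [pow_zero, one_mul] at this
  convert this using 1
  simp [coeff_expSeries, mul_comm]

lemma hasSum_pairTerm_one :
    HasSum (pairTerm (1 : Uq a) (expSeries α β γ 1)) 1 := by
  simpa using hasSum_pairTerm_N_pow (a := a) (α := α) (β := β) (γ := γ) (φ := 1) 0

end Exponential

/-! ### The character -/

/-- Left multiplication by `k` multiplies by `c` the pairings with all the series
`e^{αμ} e^{βx} e^{γt} φ(v)`. -/
def IsEigen (α β γ : ℂ) (k : Uq a) (c : ℂ) : Prop :=
  ∀ (φ : PowerSeries ℂ) (h : Uq a) (S : ℂ), HasSum (pairTerm h (expSeries α β γ φ)) S →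
    HasSum (pairTerm (k * h) (expSeries α β γ φ)) (c * S)

variable {α β γ : ℂ}

/-- The eigenvalue is seen on the pairing of the series with `φ = 1` and the unit of `U_q`. -/
lemma IsEigen.unique {k : Uq a} {c c' : ℂ} (h : IsEigen α β γ k c) (h' : IsEigen α β γ k c') :
    c = c' := by
  simpa using (h 1 1 1 hasSum_pairTerm_one).unique (h' 1 1 1 hasSum_pairTerm_one)

lemma IsEigen.add {k k' : Uq a} {c c' : ℂ} (h : IsEigen α β γ k c) (h' : IsEigen α β γ k' c') :
    IsEigen α β γ (k + k') (c + c') := fun φ w S hS => by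
  rw [add_mul, add_mul, pairTerm_add]
  exact (h φ w S hS).add (h' φ w S hS)

lemma IsEigen.mul {k k' : Uq a} {c c' : ℂ} (h : IsEigen α β γ k c) (h' : IsEigen α β γ k' c') :
    IsEigen α β γ (k * k') (c * c') := fun φ w S hS => by
  rw [mul_assoc, mul_assoc]
  exact h φ _ _ (h' φ w S hS)

lemma isEigen_algebraMap (c : ℂ) : IsEigen α β γ (algebraMap ℂ (Uq a) c) c := fun φ w S hS => by
  rw [← Algebra.smul_def, pairTerm_smul]
  exact hS.mul_left c

lemma exists_isEigen (α β γ : ℂ) {k : Uq a} (hk : k ∈ K a) : ∃ c, IsEigen α β γ k c := by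
  induction hk using Algebra.adjoin_induction with
  | mem k hk =>
    simp only [Set.mem_insert_iff, Set.mem_singleton_iff] at hk
    rcases hk with rfl | rfl | rfl | rfl | rfl
    · exact ⟨_, fun _ _ _ => hasSum_pairTerm_I_mul⟩
    · exact ⟨_, fun _ _ _ => hasSum_pairTerm_P_mul⟩
    · exact ⟨_, fun _ _ _ => hasSum_pairTerm_H_mul⟩
    · exact ⟨_, fun _ _ _ => hasSum_pairTerm_E_mul⟩
    · exact ⟨_, fun _ _ _ => hasSum_pairTerm_E'_mul⟩
  | algebraMap r => exact ⟨r, isEigen_algebraMap r⟩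
  | add k k' _ _ h h' =>
    obtain ⟨c, hc⟩ := h
    obtain ⟨c', hc'⟩ := h'
    exact ⟨_, hc.add hc'⟩
  | mul k k' _ _ h h' =>
    obtain ⟨c, hc⟩ := h
    obtain ⟨c', hc'⟩ := h'
    exact ⟨_, hc.mul hc'⟩

variable (a α β γ) in
/-- The character of `K` by which it acts on the series `e^{αμ} e^{βx} e^{γt} φ(v)`. -/
def eigenChar : K a →ₐ[ℂ] ℂ :=
  have hc := fun k : K a => (exists_isEigen α β γ k.2).choose_spec
  { toFun := fun k => (exists_isEigen α β γ k.2).choose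
    map_one' := (hc 1).unique (by simpa using isEigen_algebraMap (a := a) 1)
    map_mul' := fun k k' => (hc (k * k')).unique ((hc k).mul (hc k'))
    map_zero' := (hc 0).unique (by simpa using isEigen_algebraMap (a := a) 0)
    map_add' := fun k k' => (hc (k + k')).unique ((hc k).add (hc k'))
    commutes' := fun r => (hc (algebraMap ℂ (K a) r)).unique (isEigen_algebraMap r) }

lemma isEigen_eigenChar (k : K a) : IsEigen α β γ (k : Uq a) (eigenChar a α β γ k) :=
  (exists_isEigen α β γ k.2).choose_spec

lemma isCharacter_eigenChar : IsCharacter α β γ (eigenChar a α β γ) := by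
  have hI : eigenChar a α β γ (kI a) = α :=
    (isEigen_eigenChar (kI a)).unique fun _ _ _ => hasSum_pairTerm_I_mul
  have hP : eigenChar a α β γ (kP a) = β :=
    (isEigen_eigenChar (kP a)).unique fun _ _ _ => hasSum_pairTerm_P_mul
  have hH : eigenChar a α β γ (kH a) = γ :=
    (isEigen_eigenChar (kH a)).unique fun _ _ _ => hasSum_pairTerm_H_mul
  refine ⟨fun p q r => by rw [map_mul, map_mul, map_pow, map_pow, map_pow, hI, hP, hH],
    (isEigen_eigenChar (kE a)).unique fun _ _ _ => hasSum_pairTerm_E_mul,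
    (isEigen_eigenChar (kE' a)).unique fun _ _ _ => hasSum_pairTerm_E'_mul⟩

lemma IsCharacter.eq {χ χ' : K a →ₐ[ℂ] ℂ} (h : IsCharacter α β γ χ) (h' : IsCharacter α β γ χ') :
    χ = χ' := by
  refine AlgHom.adjoin_ext fun k hk => ?_
  simp only [Set.mem_insert_iff, Set.mem_singleton_iff] at hk
  rcases hk with rfl | rfl | rfl | rfl | rfl
  · change χ (kI a) = χ' (kI a)
    simpa using (h.1 1 0 0).trans (h'.1 1 0 0).symm
  · change χ (kP a) = χ' (kP a)
    simpa using (h.1 0 1 0).trans (h'.1 0 1 0).symm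
  · change χ (kH a) = χ' (kH a)
    simpa using (h.1 0 0 1).trans (h'.1 0 0 1).symm
  · exact h.2.1.trans h'.2.1.symm
  · exact h.2.2.trans h'.2.2.symm

lemma IsCharacter.isEigen {χ : K a →ₐ[ℂ] ℂ} (h : IsCharacter α β γ χ) (k : K a) :
    IsEigen α β γ (k : Uq a) (χ k) := by
  rw [h.eq isCharacter_eigenChar]
  exact isEigen_eigenChar k

/-- As `U_q` is spanned by the products `k N ^ s`, convergence reduces to that for `N ^ s`, where
the sum has a single term. -/
lemma summable_pairTerm (ha : a ≠ 0) (φ : PowerSeries ℂ) (h : Uq a) :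
    Summable (pairTerm h (expSeries α β γ φ)) := by
  induction mem_spanKN ha h using Submodule.span_induction with
  | mem w hw =>
    obtain ⟨k, hk, s, rfl⟩ := hw
    obtain ⟨c, hc⟩ := exists_isEigen α β γ hk
    exact (hc φ _ _ (hasSum_pairTerm_N_pow s)).summable
  | zero =>
    have : pairTerm (0 : Uq a) (expSeries α β γ φ) = 0 := by
      simpa using pairTerm_smul 0 (0 : Uq a) (expSeries α β γ φ)
    rw [this]; exact summable_zero
  | add w w' _ _ h h' => rw [pairTerm_add]; exact h.add h'
  | smul c w _ h => rw [pairTerm_smul]; exact h.mul_left c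

/-- The formal series equivariant under a character are the series `e^{αμ} e^{βx} e^{γt} φ(v)`. -/
lemma isEquivariant_iff (ha : a ≠ 0) {χ : K a →ₐ[ℂ] ℂ} (hχ : IsCharacter α β γ χ)
    (f : MvPowerSeries (Fin 4) ℂ) :
    IsEquivariant χ f ↔ ∃ φ : PowerSeries ℂ, f = expSeries α β γ φ := by
  constructor
  · rintro ⟨-, h⟩
    refine ⟨PowerSeries.mk fun s => MvPowerSeries.coeff (Finsupp.single 3 s) f,
      MvPowerSeries.ext fun m => ?_⟩
    -- Equivariance relates the pairings with `I^p P^q H^r N^s` and with `N^s`, which are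
    -- coefficients of `f` up to factorials.
    have h1 := hasSum_pairTerm_basis (a := a) (m 0) (m 1) (m 2) (m 3) f rfl rfl rfl rfl
    have h2 := hasSum_pairTerm_basis (a := a) 0 0 0 (m 3) f (m := Finsupp.single 3 (m 3))
      (by simp) (by simp) (by simp) (by simp)
    simp only [pow_zero, one_mul, Nat.factorial_zero] at h2
    have h3 := h (kI a ^ m 0 * kP a ^ m 1 * kH a ^ m 2) (N a ^ m 3)
    rw [hχ.1, h2.tsum_eq] at h3
    have h4 := h1.tsum_eq.symm.trans h3
    have hfac : ∀ n : ℕ, ((n.factorial : ℕ) : ℂ) ≠ 0 := fun n => by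
      exact_mod_cast n.factorial_ne_zero
    have e0 := hfac (m 0)
    have e1 := hfac (m 1)
    have e2 := hfac (m 2)
    have e3 := hfac (m 3)
    rw [coeff_expSeries, PowerSeries.coeff_mk]
    push_cast at h4
    field_simp
    apply mul_right_cancel₀ e3
    linear_combination h4
  · rintro ⟨φ, rfl⟩
    refine ⟨summable_pairTerm ha φ, fun k h => ?_⟩
    exact (hχ.isEigen k φ h _ (summable_pairTerm ha φ h).hasSum).tsum_eq

/-! ### Representations of `U_q` on `ℂ[[v]]` in which `N` is the derivative -/

section Multiplication

open PowerSeries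

variable {χ : K a → ℂ} {ρ : Uq a →ₐ[ℂ] Module.End ℂ (PowerSeries ℂ)}
  (hN : ∀ φ, ρ (N a) φ = derivative ℂ φ)
  (hK : ∀ (k : K a) φ, constantCoeff (ρ (k : Uq a) φ) = χ k * constantCoeff φ)

include hN in
/-- In additive form, `[d/dv, ρ(k)] = ρ([N, k])`. -/
lemma derivative_rho {k k' : Uq a} (h : N a * k = k * N a + k') (φ : PowerSeries ℂ) :
    derivative ℂ (ρ k φ) = ρ k (derivative ℂ φ) + ρ k' φ := by
  rw [← hN, ← hN, ← Module.End.mul_apply, ← map_mul, h, map_add, map_mul]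
  rfl

include hN in
lemma derivative_rho_one {k k' : Uq a} (h : N a * k = k * N a + k') :
    derivative ℂ (ρ k 1) = ρ k' 1 := by
  rw [derivative_rho hN h, Derivation.map_one_eq_zero, map_zero, zero_add]

include hN hK in
/-- The elements of `K` act by multiplications: their commutators with the derivative lie in `K`
again, so the coefficients of `ρ(k) φ` and of `ρ(k) 1 · φ` satisfy the same recursion. -/
lemma rho_apply (ha : a ≠ 0) {k : Uq a} (hk : k ∈ K a) (φ : PowerSeries ℂ) :
    ρ k φ = ρ k 1 * φ := by
  ext n
  induction n generalizing k φ with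
  | zero =>
    have h1 := hK ⟨k, hk⟩ φ
    have h2 := hK ⟨k, hk⟩ 1
    simp only [map_one, mul_one] at h2
    rw [coeff_zero_eq_constantCoeff_apply, coeff_zero_eq_constantCoeff_apply, map_mul, h2, h1]
  | succ n ih =>
    obtain ⟨k', hk', e⟩ := exists_N_mul ha hk
    have h1 : coeff n (derivative ℂ (ρ k φ)) = coeff n (derivative ℂ (ρ k 1 * φ)) := by
      rw [derivative_rho hN e, map_add, ih hk, ih hk', Derivation.leibniz, derivative_rho_one hN e,
        map_add, smul_eq_mul, smul_eq_mul, mul_comm φ]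
    rw [coeff_derivative, coeff_derivative] at h1
    exact mul_right_cancel₀ (by exact_mod_cast n.succ_ne_zero) h1

lemma derivative_rescale (c : ℂ) (f : PowerSeries ℂ) :
    derivative ℂ (rescale c f) = c • rescale c (derivative ℂ f) := by
  ext n
  simp only [coeff_derivative, coeff_rescale, map_smul, smul_eq_mul]
  ring

lemma derivative_one_add_smul_X (c : ℂ) : derivative ℂ (1 + c • X) = C c := by
  simp [smul_eq_C_mul]

section ClosedForms

variable (ha : a ≠ 0)
  (hI : χ (kI a) = α) (hP : χ (kP a) = β) (hH : χ (kH a) = γ)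
  (hE : χ (kE a) = Complex.exp (a * β)) (hE' : χ (kE' a) = Complex.exp (-(a * β)))

include hK in
lemma constantCoeff_rho_one (k : K a) : constantCoeff (ρ (k : Uq a) 1) = χ k := by
  rw [hK, map_one, mul_one]

include hN hK ha in
lemma rho_mul_one {k : Uq a} (hk : k ∈ K a) (k' : Uq a) : ρ (k * k') 1 = ρ k 1 * ρ k' 1 := by
  rw [map_mul, Module.End.mul_apply, rho_apply hN hK ha hk]

include hN hK ha in
lemma rho_pow_one {k : Uq a} (hk : k ∈ K a) (n : ℕ) : ρ (k ^ n) 1 = ρ k 1 ^ n := by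
  induction n with
  | zero => simp
  | succ n ih => rw [pow_succ', rho_mul_one hN hK ha hk, ih, pow_succ']

lemma exp_neg_two_mul (a β : ℂ) :
    Complex.exp (-2 * a * β) = Complex.exp (-(a * β)) ^ 2 := by
  rw [← Complex.exp_nat_mul]; congr 1; push_cast; ring

include hN hK ha hI hE' in
/-- The product `e^{-2aP} I²` is central, so that `[I, N] = -a e^{-2aP} I²` forces `ρ(I) 1` to be
affine. -/
lemma rho_I_one : ρ (I a) 1 = α • (1 + (a * α * Complex.exp (-2 * a * β)) • X) := by
  have cI : constantCoeff (ρ (I a) 1) = α := (constantCoeff_rho_one hK (kI a)).trans hI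
  have cE' : constantCoeff (ρ (E' a) 1) = Complex.exp (-(a * β)) :=
    (constantCoeff_rho_one hK (kE' a)).trans hE'
  have dI : derivative ℂ (ρ (I a) 1) = a • (ρ (E' a) 1 ^ 2 * ρ (I a) 1 ^ 2) := by
    rw [derivative_rho_one hN (N_mul_I ha), map_smul, LinearMap.smul_apply,
      rho_mul_one hN hK ha (pow_mem E'_mem_K 2), rho_pow_one hN hK ha E'_mem_K,
      rho_pow_one hN hK ha I_mem_K]
  have dE' : derivative ℂ (ρ (E' a) 1) = (-a) • (ρ (E' a) 1 ^ 3 * ρ (I a) 1) := by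
    rw [derivative_rho_one hN (N_mul_E' ha), map_smul, LinearMap.smul_apply,
      rho_mul_one hN hK ha (pow_mem E'_mem_K 3), rho_pow_one hN hK ha E'_mem_K]
  have hcentral : ρ (E' a) 1 ^ 2 * ρ (I a) 1 ^ 2 = C (Complex.exp (-2 * a * β) * α ^ 2) := by
    refine derivative.ext ?_ ?_
    · rw [Derivation.leibniz, Derivation.leibniz_pow, Derivation.leibniz_pow, dI, dE',
        derivative_C]
      simp only [smul_eq_mul, smul_eq_C_mul, nsmul_eq_mul, map_neg]
      push_cast
      ring
    · rw [map_mul, map_pow, map_pow, cI, cE', constantCoeff_C, exp_neg_two_mul]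
  refine derivative.ext ?_ ?_
  · rw [dI, hcentral, Derivation.map_smul, derivative_one_add_smul_X]
    simp only [smul_eq_C_mul, map_mul, map_pow]
    ring
  · simp [cI]

lemma one_add_smul_X_mul_inv (c : ℂ) :
    (1 + c • X : PowerSeries ℂ) * (1 + c • X)⁻¹ = 1 :=
  PowerSeries.mul_inv_cancel _ (by simp)

include hN hK ha hI hE hE' in
/-- `ρ(e^{2aP}) 1` is computed from `[e^{2aP}, N] = -2a I`, and `ρ(e^{-2aP}) 1` is its inverse. -/
lemma rho_E'_one_sq : ρ (E' a) 1 ^ 2 = Complex.exp (-2 * a * β) •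
    (1 + (a * α * Complex.exp (-2 * a * β)) • X)⁻¹ ^ 2 := by
  have cE : constantCoeff (ρ (E a) 1) = Complex.exp (a * β) :=
    (constantCoeff_rho_one hK (kE a)).trans hE
  have hEE' : ρ (E a) 1 * ρ (E' a) 1 = 1 := by
    rw [← rho_mul_one hN hK ha E_mem_K, E_mul_E', map_one ρ]; rfl
  have dE : derivative ℂ (ρ (E a) 1) = a • (ρ (E' a) 1 * ρ (I a) 1) := by
    rw [derivative_rho_one hN (N_mul_E ha), map_smul, LinearMap.smul_apply,
      rho_mul_one hN hK ha E'_mem_K]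
  have hexp : Complex.exp (a * β) ^ 2 * Complex.exp (-2 * a * β) = 1 := by
    rw [exp_neg_two_mul, ← mul_pow, ← Complex.exp_add]; simp
  have hexpC := congrArg (C (R := ℂ)) hexp
  simp only [map_mul, map_pow, map_one] at hexpC
  set e := Complex.exp (-2 * a * β) with he
  have hE2 : ρ (E a) 1 ^ 2 = Complex.exp (a * β) ^ 2 • (1 + (a * α * e) • X) ^ 2 := by
    refine derivative.ext ?_ ?_
    · rw [Derivation.leibniz_pow, Derivation.map_smul, Derivation.leibniz_pow,
        derivative_one_add_smul_X, dE, rho_I_one hN hK ha hI hE', ← he]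
      simp only [smul_eq_mul, smul_eq_C_mul, nsmul_eq_mul, map_mul, map_pow, Nat.add_one_sub_one,
        pow_one]
      push_cast
      linear_combination (2 * C a * C α * (1 + C a * C α * C e * X)) * (hEE' - hexpC)
    · simp [cE]
  have hu := one_add_smul_X_mul_inv (a * α * e)
  set u := (1 + (a * α * e) • X : PowerSeries ℂ)⁻¹
  set w := (1 + (a * α * e) • X : PowerSeries ℂ)
  rw [smul_eq_C_mul] at hE2 ⊢
  rw [map_pow] at hE2
  calc ρ (E' a) 1 ^ 2 = (C (Complex.exp (a * β)) ^ 2 * C e) * (w * u) ^ 2 * ρ (E' a) 1 ^ 2 := by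
        rw [hexpC, hu]; ring
    _ = (ρ (E a) 1 * ρ (E' a) 1) ^ 2 * (C e * u ^ 2) := by
        rw [mul_pow _ (ρ (E' a) 1), hE2]; ring
    _ = C e * u ^ 2 := by rw [hEE']; ring

include hN hK ha hI hP hE hE' in
/-- `[P, N] = -e^{-2aP} I` gives the derivative of `ρ(P) 1`, which is that of the logarithm. -/
lemma rho_P_one : ρ (P a) 1 = C β + (1 / a) • rescale (a * α * Complex.exp (-2 * a * β))
    (log ℂ) := by
  have cP : constantCoeff (ρ (P a) 1) = β := (constantCoeff_rho_one hK (kP a)).trans hP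
  set c := a * α * Complex.exp (-2 * a * β) with hc
  have hu := one_add_smul_X_mul_inv c
  have hlog := congrArg (rescale c) one_add_X_mul_derivative_log
  simp only [map_mul, map_add, map_one, rescale_X, ← smul_eq_C_mul] at hlog
  have hlog' : rescale c (derivative ℂ (log ℂ)) = (1 + c • X)⁻¹ := by
    linear_combination (1 + c • X)⁻¹ * hlog - rescale c (derivative ℂ (log ℂ)) * hu
  refine derivative.ext ?_ ?_
  · rw [derivative_rho_one hN (N_mul_P ha), rho_mul_one hN hK ha (pow_mem E'_mem_K 2),
      rho_pow_one hN hK ha E'_mem_K, rho_E'_one_sq hN hK ha hI hE hE', rho_I_one hN hK ha hI hE',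
      map_add, derivative_C, Derivation.map_smul, derivative_rescale, hlog', ← hc, smul_smul,
      zero_add]
    have h1 : 1 / a * c = Complex.exp (-2 * a * β) * α := by rw [hc]; field_simp
    rw [h1]
    simp only [smul_eq_C_mul, map_mul] at hu ⊢
    linear_combination (C (Complex.exp (-2 * a * β)) * C α * (1 + C c * X)⁻¹) * hu
  · have hlog0 : constantCoeff (rescale c (log ℂ)) = 0 := by
      rw [← coeff_zero_eq_constantCoeff_apply, coeff_rescale, coeff_zero_eq_constantCoeff_apply,
        constantCoeff_log, mul_zero]
    rw [cP, map_add, constantCoeff_C, smul_eq_C_mul, map_mul, hlog0, mul_zero, add_zero]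

include hN hK ha hI hH hE hE' in
/-- `[H, N] = -(1 - e^{-2aP}) / 2a` gives the derivative of `ρ(H) 1`. -/
lemma rho_H_one : ρ (H a) 1 = C γ + (1 / (2 * a)) • ((1 - Complex.exp (-2 * a * β) •
    (1 + (a * α * Complex.exp (-2 * a * β)) • X)⁻¹) * X) := by
  have cH : constantCoeff (ρ (H a) 1) = γ := (constantCoeff_rho_one hK (kH a)).trans hH
  have hsq := rho_E'_one_sq hN hK ha hI hE hE'
  set c := a * α * Complex.exp (-2 * a * β) with hc
  have hu := one_add_smul_X_mul_inv c
  have hd : derivative ℂ ((1 + c • X)⁻¹ : PowerSeries ℂ) = -(1 + c • X)⁻¹ ^ 2 * C c := by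
    rw [← derivative_one_add_smul_X]
    exact derivative_inv' _
  refine derivative.ext ?_ ?_
  · rw [derivative_rho_one hN (N_mul_H ha), map_smul, LinearMap.smul_apply, map_add, map_smul,
      map_one ρ, LinearMap.add_apply, LinearMap.smul_apply, rho_pow_one hN hK ha E'_mem_K, hsq]
    rw [map_add, derivative_C, Derivation.map_smul, zero_add, Derivation.leibniz, map_sub,
      Derivation.map_smul, hd,
      Derivation.map_one_eq_zero, derivative_X]
    simp only [smul_eq_C_mul, map_neg, map_one, smul_eq_mul, Module.End.one_apply] at hu ⊢
    linear_combination (-C (1 / (2 * a)) * C (Complex.exp (-2 * a * β)) * (1 + C c * X)⁻¹) * hu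
  · simp [cH]

end ClosedForms

end Multiplication

/-! ### The coinduced representation -/

/-- The linear form `⟨e^{αμ} e^{βx} e^{γt} φ(v), ·⟩` on `U_q`. -/
def pairForm (ha : a ≠ 0) (α β γ : ℂ) (φ : PowerSeries ℂ) : Uq a →ₗ[ℂ] ℂ where
  toFun h := ∑' m, pairTerm h (expSeries α β γ φ) m
  map_add' h h' := by
    rw [pairTerm_add]
    exact (summable_pairTerm ha φ h).tsum_add (summable_pairTerm ha φ h')
  map_smul' c h := by
    rw [pairTerm_smul]
    exact tsum_mul_left

lemma hasSum_pairForm (ha : a ≠ 0) (φ : PowerSeries ℂ) (h : Uq a) :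
    HasSum (pairTerm h (expSeries α β γ φ)) (pairForm ha α β γ φ h) :=
  (summable_pairTerm ha φ h).hasSum

lemma pairForm_N_pow (ha : a ≠ 0) (φ : PowerSeries ℂ) (s : ℕ) :
    pairForm ha α β γ φ (N a ^ s) = s.factorial * PowerSeries.coeff s φ :=
  (hasSum_pairTerm_N_pow s).tsum_eq

/-- An element of the coinduced space is determined by its values at the powers of `N`. -/
lemma coinduced_ext (ha : a ≠ 0) {χ : K a →ₐ[ℂ] ℂ} {F G : coinduced χ}
    (h : ∀ s : ℕ, (F : Uq a →ₗ[ℂ] ℂ) (N a ^ s) = (G : Uq a →ₗ[ℂ] ℂ) (N a ^ s)) : F = G := by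
  refine Subtype.ext (LinearMap.ext fun w => ?_)
  induction mem_spanKN ha w using Submodule.span_induction with
  | mem w hw =>
    obtain ⟨k, hk, s, rfl⟩ := hw
    exact (F.2 ⟨k, hk⟩ (N a ^ s)).trans ((congrArg _ (h s)).trans (G.2 ⟨k, hk⟩ (N a ^ s)).symm)
  | zero => simp
  | add w w' _ _ h h' => rw [map_add, map_add, h, h']
  | smul c w _ h => rw [map_smul, map_smul, h]

/-- The isomorphism of `ℂ[[v]]` onto the coinduced space. -/
def coinducedEquiv (ha : a ≠ 0) {χ : K a →ₐ[ℂ] ℂ} (hχ : IsCharacter α β γ χ) :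
    PowerSeries ℂ ≃ₗ[ℂ] coinduced χ where
  toFun φ := ⟨pairForm ha α β γ φ, fun k h =>
    (hχ.isEigen k φ h _ (hasSum_pairForm ha φ h)).tsum_eq⟩
  map_add' φ ψ := coinduced_ext ha fun s => by simp [pairForm_N_pow, mul_add]
  map_smul' c φ := coinduced_ext ha fun s => by simp [pairForm_N_pow]; ring
  invFun F := PowerSeries.mk fun s => (F : Uq a →ₗ[ℂ] ℂ) (N a ^ s) / s.factorial
  left_inv φ := by
    ext s
    have : ((s.factorial : ℕ) : ℂ) ≠ 0 := by exact_mod_cast s.factorial_ne_zero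
    rw [PowerSeries.coeff_mk, pairForm_N_pow]
    field_simp
  right_inv F := coinduced_ext ha fun s => by
    have : ((s.factorial : ℕ) : ℂ) ≠ 0 := by exact_mod_cast s.factorial_ne_zero
    rw [pairForm_N_pow, PowerSeries.coeff_mk]
    field_simp

lemma coinducedEquiv_N_pow (ha : a ≠ 0) {χ : K a →ₐ[ℂ] ℂ} (hχ : IsCharacter α β γ χ)
    (φ : PowerSeries ℂ) (s : ℕ) :
    (coinducedEquiv ha hχ φ : Uq a →ₗ[ℂ] ℂ) (N a ^ s) = s.factorial * PowerSeries.coeff s φ :=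
  pairForm_N_pow ha φ s

lemma coinducedRep_apply {χ : K a →ₐ[ℂ] ℂ} (h h' : Uq a) (F : coinduced χ) :
    (coinducedRep χ h F : Uq a →ₗ[ℂ] ℂ) h' = (F : Uq a →ₗ[ℂ] ℂ) (h' * h) := rfl

lemma coinducedRep_N (ha : a ≠ 0) {χ : K a →ₐ[ℂ] ℂ} (hχ : IsCharacter α β γ χ)
    (φ : PowerSeries ℂ) : coinducedRep χ (N a) (coinducedEquiv ha hχ φ) =
      coinducedEquiv ha hχ (PowerSeries.derivative ℂ φ) :=
  coinduced_ext ha fun s => by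
    rw [coinducedRep_apply, ← pow_succ, coinducedEquiv_N_pow, coinducedEquiv_N_pow,
      PowerSeries.coeff_derivative, Nat.factorial_succ]
    push_cast
    ring

/-- The coinduced representation, carried over to `ℂ[[v]]`. -/
def powerSeriesRep (ha : a ≠ 0) {χ : K a →ₐ[ℂ] ℂ} (hχ : IsCharacter α β γ χ) :
    Uq a →ₐ[ℂ] Module.End ℂ (PowerSeries ℂ) :=
  ((coinducedEquiv ha hχ).symm.conjAlgEquiv ℂ).toAlgHom.comp (coinducedRep χ)

lemma coinducedEquiv_powerSeriesRep (ha : a ≠ 0) {χ : K a →ₐ[ℂ] ℂ} (hχ : IsCharacter α β γ χ)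
    (h : Uq a) (φ : PowerSeries ℂ) : coinducedEquiv ha hχ (powerSeriesRep ha hχ h φ) =
      coinducedRep χ h (coinducedEquiv ha hχ φ) :=
  (coinducedEquiv ha hχ).apply_symm_apply _

lemma powerSeriesRep_N (ha : a ≠ 0) {χ : K a →ₐ[ℂ] ℂ} (hχ : IsCharacter α β γ χ)
    (φ : PowerSeries ℂ) : powerSeriesRep ha hχ (N a) φ = PowerSeries.derivative ℂ φ :=
  (coinducedEquiv ha hχ).injective <| by
    rw [coinducedEquiv_powerSeriesRep, coinducedRep_N]

/-- The constant term of `φ` is the value at `1` of the corresponding form, on which equivariance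
applies. -/
lemma constantCoeff_powerSeriesRep (ha : a ≠ 0) {χ : K a →ₐ[ℂ] ℂ} (hχ : IsCharacter α β γ χ)
    (k : K a) (φ : PowerSeries ℂ) :
    PowerSeries.constantCoeff (powerSeriesRep ha hχ (k : Uq a) φ) =
      χ k * PowerSeries.constantCoeff φ := by
  have hval : ∀ ψ : PowerSeries ℂ, PowerSeries.constantCoeff ψ =
      (coinducedEquiv ha hχ ψ : Uq a →ₗ[ℂ] ℂ) 1 := fun ψ => by
    simpa using (coinducedEquiv_N_pow ha hχ ψ 0).symm
  rw [hval, hval, coinducedEquiv_powerSeriesRep, coinducedRep_apply, one_mul]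
  simpa using (coinducedEquiv ha hχ φ).2 k 1

/-- An element of `K` acts on the coinduced space by the multiplication by the series to which it
sends `1`. -/
lemma coinducedRep_of_mem_K (ha : a ≠ 0) {χ : K a →ₐ[ℂ] ℂ} (hχ : IsCharacter α β γ χ) {k : Uq a}
    (hk : k ∈ K a) {g : PowerSeries ℂ} (hg : powerSeriesRep ha hχ k 1 = g) (φ : PowerSeries ℂ) :
    coinducedRep χ k (coinducedEquiv ha hχ φ) = coinducedEquiv ha hχ (g * φ) := by
  rw [← coinducedEquiv_powerSeriesRep, rho_apply (χ := χ) (powerSeriesRep_N ha hχ)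
    (constantCoeff_powerSeriesRep ha hχ) ha hk, hg]

end Uq
end QGalilei
end

theorem mainTheorem3 (a : ℂ) (ha : a ≠ 0) :
    -- duality of the bases, the exponentials of `P`, and the commutation relations of `U_q`
    (∀ p q r s p' q' r' s' : ℕ,
      pair (I a ^ p * P a ^ q * H a ^ r * N a ^ s) (mu a ^ p' * x a ^ q' * t a ^ r' * v a ^ s') =
        if p = p' ∧ q = q' ∧ r = r' ∧ s = s' then
          ((p.factorial * q.factorial * r.factorial * s.factorial : ℕ) : ℂ) else 0) ∧
    (∀ f : Fq a,
      HasSum (fun n : ℕ => a ^ n / n.factorial * pair (P a ^ n) f) (pair (E a) f) ∧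
      HasSum (fun n : ℕ => (-a) ^ n / n.factorial * pair (P a ^ n) f) (pair (E' a) f)) ∧
    (I a * P a = P a * I a ∧ I a * H a = H a * I a ∧ P a * H a = H a * P a ∧
      I a * N a - N a * I a = -(a • (E' a ^ 2 * I a ^ 2)) ∧
      P a * N a - N a * P a = -(E' a ^ 2 * I a) ∧
      H a * N a - N a * H a = -((1 / (2 * a)) • (1 - E' a ^ 2))) ∧
    -- the regular actions are dual to the products of `U_q`
    (∀ (h h' : Uq a) (f : Fq a),
      pair h' (leftAct h f) = pair (h' * h) f ∧ pair h' (rightAct h f) = pair (h * h') f) ∧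
    -- the left regular action
    (leftAct (I a) = (1 + tOp a) * pd a 0 ∧
      leftAct (P a) = pd a 1 + (1 / a) • seriesOp (PowerSeries.log ℂ) (tOp a) (tOp_locNil a) ∧
      leftAct (H a) = pd a 2 + (1 / (2 * a)) •
        (bar a 3 * (1 - shiftOp a * seriesOp (1 + PowerSeries.X)⁻¹ (tOp a) (tOp_locNil a))) ∧
      leftAct (N a) = pd a 3) ∧
    -- the right regular action
    (rightAct (I a) = pd a 0 ∧ rightAct (P a) = pd a 1 ∧ rightAct (H a) = pd a 2 ∧
      rightAct (N a) = pd a 3 + a • (bar a 0 * shiftOp a * pd a 0 ^ 2) +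
        bar a 1 * shiftOp a * pd a 0 + (1 / (2 * a)) • (bar a 2 * (1 - shiftOp a))) ∧
    -- the coinduced representations
    ∀ α β γ : ℂ,
      (∃! χ : K a →ₐ[ℂ] ℂ, IsCharacter α β γ χ) ∧
      ∀ χ : K a →ₐ[ℂ] ℂ, IsCharacter α β γ χ →
        (∀ f : MvPowerSeries (Fin 4) ℂ,
          IsEquivariant χ f ↔ ∃ φ : PowerSeries ℂ, f = expSeries α β γ φ) ∧
        ∃ Φ : PowerSeries ℂ ≃ₗ[ℂ] coinduced χ,
          (∀ (φ : PowerSeries ℂ) (h : Uq a),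
            HasSum (pairTerm h (expSeries α β γ φ)) ((Φ φ : Uq a →ₗ[ℂ] ℂ) h)) ∧
          ∀ φ : PowerSeries ℂ,
            coinducedRep χ (I a) (Φ φ) =
              Φ (α • ((1 + (a * α * Complex.exp (-2 * a * β)) • PowerSeries.X) * φ)) ∧
            coinducedRep χ (P a) (Φ φ) =
              Φ ((PowerSeries.C β + (1 / a) • PowerSeries.rescale
                (a * α * Complex.exp (-2 * a * β)) (PowerSeries.log ℂ)) * φ) ∧
            coinducedRep χ (H a) (Φ φ) =
              Φ ((PowerSeries.C γ + (1 / (2 * a)) •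
                ((1 - Complex.exp (-2 * a * β) •
                  (1 + (a * α * Complex.exp (-2 * a * β)) • PowerSeries.X)⁻¹) *
                    PowerSeries.X)) * φ) ∧
            coinducedRep χ (N a) (Φ φ) = Φ (PowerSeries.derivative ℂ φ) := by
  refine ⟨fun p q r s p' q' r' s' => ?_, fun f => ⟨?_, ?_⟩,
    ⟨I_mul_P, I_mul_H, P_mul_H, I_comm_N ha, P_comm_N ha, H_comm_N ha⟩,
    fun h h' f => ⟨pair_leftAct h h' f, pair_rightAct h h' f⟩,
    ⟨leftAct_I, leftAct_P ha, leftAct_H ha, leftAct_N⟩,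
    ⟨rightAct_I, rightAct_P, rightAct_H, rightAct_N ha⟩,
    fun α β γ => ⟨⟨eigenChar a α β γ, isCharacter_eigenChar,
      fun χ hχ => hχ.eq isCharacter_eigenChar⟩, fun χ hχ =>
      ⟨isEquivariant_iff ha hχ, coinducedEquiv ha hχ, fun φ h => hasSum_pairForm ha φ h,
        fun φ => ?_⟩⟩⟩
  · have h := pair_basis_ordMon (a := a) p q r s (Finsupp.single 0 p' + Finsupp.single 1 q' +
      Finsupp.single 2 r' + Finsupp.single 3 s')
    simpa [ordMon] using h
  · have h := hasSum_exp_mul_pair_P_pow a (1 : Uq a) f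
    simp only [mul_one, pair_one] at h
    rwa [pair_eq_counit_rightAct, rightAct_E]
  · have h := hasSum_exp_mul_pair_P_pow (-a) (1 : Uq a) f
    simp only [mul_one, pair_one] at h
    rwa [pair_eq_counit_rightAct, rightAct_E']
  · have hN := powerSeriesRep_N ha hχ
    have hK := constantCoeff_powerSeriesRep ha hχ
    have hI : χ (kI a) = α := by simpa using hχ.1 1 0 0
    have hP : χ (kP a) = β := by simpa using hχ.1 0 1 0
    have hH : χ (kH a) = γ := by simpa using hχ.1 0 0 1
    refine ⟨?_, ?_, ?_, coinducedRep_N ha hχ φ⟩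
    · rw [← smul_mul_assoc]
      exact coinducedRep_of_mem_K ha hχ I_mem_K (rho_I_one hN hK ha hI hχ.2.2) φ
    · exact coinducedRep_of_mem_K ha hχ P_mem_K (rho_P_one hN hK ha hI hP hχ.2.1 hχ.2.2) φ
    · exact coinducedRep_of_mem_K ha hχ H_mem_K (rho_H_one hN hK ha hI hH hχ.2.1 hχ.2.2) φ
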